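/- **Setting.** Let $x,y,z,w$ be homogeneous coordinates on $\mathbb{RP}^3$, let $L_\infty=\{z=w=0\}$, and identify $\{w\neq 0\}$ with $\mathbb R^3$. Let $\mathbb B\subset\mathbb{RP}^3$ be a convex-concave body with respect to $L_\infty$. This means that $\mathbb B$ is closed and disjoint from $L_\infty$, that its section by every plane $N\supset L_\infty$ is a convex subset of the affine plane $N\setminus L_\infty$, and that for any three distinct planes through $L_\infty$, through every point of the section by one of them there passes a line meeting the sections by the other two. Let $t_1<\dots<t_m$, let $L_i=\{z=t_i\}$ and $S_i=\mathbb B\cap L_i$. Let $H_i\subset L_i$ be a closed half-plane whose boundary line passes through the point $(0,0,t_i)$ of the $z$-axis, and suppose that $S_i$ lies in the relative interior of $H_i$ in $L_i$. Suppose also that the boundary lines $\partial H_i$ are pairwise non-parallel. Let $\pi$ be the projection $(x,y,z)\mapsto(x,y)$; all horizontal planes are identified with $\mathbb R^2$ by means of $\pi$. Write $\pi(H_i)^c$ for the closure of $\mathbb R^2\setminus\pi(H_i)$, $B_i=\pi^{-1}(\pi(H_i))$, and $B_i^c$ for the closure of $\mathbb R^3\setminus B_i$. A code of the configuration is obtained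 by choosing an orientation of the unit circle of $\mathbb R^2$ and a point $N$ of the circle on none of the lines $\partial\pi(H_i)$. Going around the circle from $N$, one writes down the numbers of the first $m$ boundary lines met, each number $i$ with the sign $+$ if $N\in\pi(H_i)$ and $-$ otherwise. **Theorem (Sectorial Browder theorem).** Let $i_1<i_2<i_3<i_4$ be indices, written $1,2,3,4$ below. Consider the conditions 1. $\pi(H_1)\cap\pi(H_4)^c\subset\pi(H_2)^c$, 2. $\pi(H_3)\cap\pi(H_2)\subset\pi(H_4)^c$. (a) Conditions 1 and 2 both hold if and only if some code of the configuration contains the subsequence $1{+}\,2{-}\,3{+}\,4{-}$. (b) Suppose that 1 and 2 hold and that $\pi(S_1)\cap\pi(H_4)^c\neq\emptyset$. Then $\pi(S_2)\cap\pi(H_3)$, $\pi(S_3)\cap\pi(H_2)$ and $\pi(S_4)\cap\pi(H_1)^c$ are non-empty, and there is a straight line in $\mathbb R^3$ that meets all of $S_1\cap B_4^c$, $S_2\cap B_3$, $S_3\cap B_2$ and $S_4\cap B_1^c$. (c) Under the assumptions of (b), let $l$ be any such line, meeting these four sets at points with projections $A',B',C',D'$ respectively. Then $\pi(l)$ meets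 each of $\partial\pi(H_1),\partial\pi(H_2),\partial\pi(H_3),\partial\pi(H_4)$ in exactly one point; these points $A,B,C,D$ are pairwise distinct. For the double ratio $(A,B,C,D)=\frac{AB}{BD}:\frac{AC}{CD}$ of lengths, $(A',B',C',D')$ equals the double ratio of the distances between the planes, $$\frac{h_1}{h_2+h_3}:\frac{h_1+h_2}{h_3},\qquad h_k=t_{i_{k+1}}-t_{i_k},$$ and $(A,B,C,D)$ equals the double ratio of the directions of the boundary lines, $$\frac{[d_1,d_2]}{[d_2,d_4]}:\frac{[d_1,d_3]}{[d_3,d_4]},$$ where $d_k$ is a direction vector of $\partial H_k$ and $[\cdot,\cdot]$ is the determinant of two vectors of $\mathbb R^2$. The double ratio of the distances is strictly greater than the double ratio of the directions: $$\frac{h_1}{h_2+h_3}:\frac{h_1+h_2}{h_3}\;>\;\frac{[d_1,d_2]}{[d_2,d_4]}:\frac{[d_1,d_3]}{[d_3,d_4]}.$$ -/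

import Mathlib

open Set Module
open scoped LinearAlgebra.Projectivization InnerProductSpace

noncomputable section

namespace SectorialBrowder

/-- The vector space underlying real projective 3-space; homogeneous coordinates `(x, y, z, w)`. -/
abbrev V4 : Type := Fin 4 → ℝ

/-- Real projective 3-space. -/
abbrev RP3 : Type := ℙ ℝ V4

/-- Affine 3-space with coordinates `(x, y, z)` and its Euclidean metric. -/
abbrev E3 : Type := EuclideanSpace ℝ (Fin 3)

/-- The `(x, y)`-plane, which stands for every horizontal plane by means of the coordinates
`x, y`. -/
abbrev E2 : Type := EuclideanSpace ℝ (Fin 2)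

/-! ### Projective convex-concave bodies -/

/-- The points of a projective subspace, given by the linear subspace `W`. -/
def projPoints (W : Submodule ℝ V4) : Set RP3 := {p | p.submodule ≤ W}

/-- `𝔹` is a closed set in `RP3` (quotient topology), disjoint from the line `L`, such that
* the section by every plane `N` through `L` is convex in the affine plane `N \ L`; this affine
  plane is realized as `{v ∈ N | f v = 1}` for a linear form `f` that vanishes on `L`
  (if `f` vanishes on `N` the set is empty, otherwise different `f` give proportional sets);
* for any three different planes through `L`, through every point of the section by one of them
  passes a line that meets the sections by the two others. -/
structure IsConvexConcave (L : Submodule ℝ V4) (𝔹 : Set RP3) : Prop where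
  isClosed : IsClosed {v : {v : V4 // v ≠ 0} | Projectivization.mk' ℝ v ∈ 𝔹}
  disjoint : Disjoint 𝔹 (projPoints L)
  convex : ∀ N : Submodule ℝ V4, finrank ℝ N = 3 → L ≤ N →
    ∀ f : V4 →ₗ[ℝ] ℝ, (∀ v ∈ L, f v = 0) →
      Convex ℝ {v : V4 | v ∈ N ∧ f v = 1 ∧ ∃ hv : v ≠ 0, Projectivization.mk ℝ v hv ∈ 𝔹}
  lines : ∀ N₁ N₂ N₃ : Submodule ℝ V4,
    finrank ℝ N₁ = 3 → finrank ℝ N₂ = 3 → finrank ℝ N₃ = 3 →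
    L ≤ N₁ → L ≤ N₂ → L ≤ N₃ → N₁ ≠ N₂ → N₁ ≠ N₃ → N₂ ≠ N₃ →
    ∀ p ∈ 𝔹 ∩ projPoints N₁, ∃ l : Submodule ℝ V4, finrank ℝ l = 2 ∧ p ∈ projPoints l ∧
      (projPoints l ∩ (𝔹 ∩ projPoints N₂)).Nonempty ∧
      (projPoints l ∩ (𝔹 ∩ projPoints N₃)).Nonempty

/-- The infinite line `z = w = 0`. -/
def infiniteLine : Submodule ℝ V4 where
  carrier := {v | v 2 = 0 ∧ v 3 = 0}
  add_mem' := by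
    rintro a b ⟨ha, ha'⟩ ⟨hb, hb'⟩
    simp [ha, ha', hb, hb']
  zero_mem' := by simp
  smul_mem' := by
    rintro c a ⟨ha, ha'⟩
    simp [ha, ha']

/-- The affine chart `(x, y, z) ↦ [x : y : z : 1]`. -/
def chart (p : E3) : RP3 :=
  Projectivization.mk ℝ ![p 0, p 1, p 2, 1] (fun h => by simpa using congrFun h 3)

/-- The section of `𝔹` by the horizontal plane `z = t`, in the affine chart. -/
def horizontalSection (𝔹 : Set RP3) (t : ℝ) : Set E3 := {p | p 2 = t ∧ chart p ∈ 𝔹}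

/-! ### Half-planes, projection along the `z`-axis -/

/-- The projection along the `z`-axis. -/
def proj (p : E3) : E2 := !₂[p 0, p 1]

/-- The closed half-plane of the plane `z = t` with inner normal `u` whose boundary line passes
through the point `(0, 0, t)` of the `z`-axis. -/
def halfPlane (u : E2) (t : ℝ) : Set E3 := {p | p 2 = t ∧ 0 ≤ ⟪u, proj p⟫_ℝ}

/-- The closure of the complement of the projection of `H`. -/
def projCompl (H : Set E3) : Set E2 := closure (proj '' H)ᶜ

/-- The full preimage of the projection of `H`. -/
def halfSpace (H : Set E3) : Set E3 := proj ⁻¹' (proj '' H)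

/-- The closure of the complement of `halfSpace H`. -/
def halfSpaceCompl (H : Set E3) : Set E3 := closure (halfSpace H)ᶜ

/-! ### Codes -/

/-- The point of the unit circle with polar angle `φ`. -/
def circlePoint (φ : ℝ) : E2 := !₂[Real.cos φ, Real.sin φ]

/-- `c` is the code of the half-planes `K i` of `E2` (with boundary lines through the origin) for
the base point `circlePoint φ` and the orientation `ε = ±1` of the unit circle. Going around the
circle from the base point, one meets each boundary line exactly once before half a turn, and these
are the first `m` of the `2 * m` intersection points of the circle with the boundary lines. The code
lists the indices in the order in which they are met, each with the sign `true` if `K i`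
contains the base point and `false` otherwise. -/
structure IsCode {m : ℕ} (K : Fin m → Set E2) (φ ε : ℝ) (c : List (Fin m × Bool)) : Prop where
  orientation : ε = 1 ∨ ε = -1
  base : ∀ i, circlePoint φ ∉ frontier (K i)
  all : ∀ i, i ∈ c.map Prod.fst
  order : ∃ θ : Fin m → ℝ,
    (∀ i, 0 < θ i ∧ θ i < Real.pi ∧ circlePoint (φ + ε * θ i) ∈ frontier (K i)) ∧
    c.Pairwise (fun a b => θ a.1 < θ b.1)
  sign : ∀ a ∈ c, (a.2 = true ↔ circlePoint φ ∈ K a.1)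

/-! ### Double ratios -/

/-- The double ratio `(AB / BD) : (AC / CD)` of four points, in terms of lengths. -/
def doubleRatio (A B C D : E2) : ℝ := (dist A B / dist B D) / (dist A C / dist C D)

/-- The direction vector of the line through the origin with normal vector `u`. -/
def boundaryDir (u : E2) : E2 := !₂[-u 1, u 0]

/-- The determinant of two vectors of the plane. -/
def det2 (a b : E2) : ℝ := a 0 * b 1 - a 1 * b 0

/-- The double ratio of the four concurrent lines with direction vectors `a, b, c, d`; the
determinants may be replaced by the sines of the oriented angles between the lines. -/
def directionRatio (a b c d : E2) : ℝ :=
  (det2 a b / det2 b d) / (det2 a c / det2 c d)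

/-- The double ratio of the distances between the planes `z = s₁`, `z = s₂`, `z = s₃`, `z = s₄`. -/
def heightRatio (s₁ s₂ s₃ s₄ : ℝ) : ℝ :=
  ((s₂ - s₁) / (s₄ - s₂)) / ((s₃ - s₁) / (s₄ - s₃))

end SectorialBrowder

end

open SectorialBrowder

namespace SectorialBrowder

/-! The two inclusions say that one linear form is non-positive on the sector cut out by two others.
In the plane this makes it a combination of them with coefficients of known sign
(`exists_pos_combination`), so both inclusions become two linear relations between the normals
(`SignRelations`), from which all signs are read off. In the language of codes, `slope` orders the
lines as they are met around the circle, and a positive combination has an intermediate slope. For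
the transversal, S₁ is cut down to the part where u₄ ≤ 0 and S₃ to the part where u₂ ≥ 0. The sign
relations show that a line from the first part through S₂ and S₃ ends in the second part, and that a
line from the second part through S₁ and S₄ starts in the first part. Compactness, convexity and
these two families of lines suffice for a common transversal, by the separation argument of
`exists_transversal`. Along a sectorial transversal the signs force the boundary lines to be crossed
in the order 1, 2 between the first two heights and 3, 4 between the last two
(`SignRelations.exists_crossings`). The double ratio of the crossing parameters is that of the
directions (`directionRatio_eq_heightRatio`), and moving the four parameters outwards to the heights
of the planes strictly increases it (`heightRatio_lt`). -/

/-! ### Common transversals of four convex sets. -/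

/-- Four compact convex sets `S₁, …, S₄` at heights `t₁, …, t₄` have a common transversal, provided
that every point of `S₁` lies on a line through `S₂` and `S₃`, and every point of `S₃` on a line
through `S₁` and `S₄`. -/
theorem exists_transversal {E : Type*} [NormedAddCommGroup E] [NormedSpace ℝ E]
    {S₁ S₂ S₃ S₄ : Set E} {t₁ t₂ t₃ t₄ : ℝ} (h₁₃ : t₁ < t₃) (h₃₄ : t₃ < t₄)
    (c₁ : IsCompact S₁) (c₂ : IsCompact S₂) (c₃ : IsCompact S₃) (c₄ : IsCompact S₄)
    (v₁ : Convex ℝ S₁) (v₂ : Convex ℝ S₂) (v₃ : Convex ℝ S₃) (v₄ : Convex ℝ S₄)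
    (hne : S₁.Nonempty)
    (hf : ∀ x ∈ S₁, ∃ a b : E, a + t₁ • b = x ∧ a + t₂ • b ∈ S₂ ∧ a + t₃ • b ∈ S₃)
    (hg : ∀ x ∈ S₃, ∃ a b : E, a + t₃ • b = x ∧ a + t₁ • b ∈ S₁ ∧ a + t₄ • b ∈ S₄) :
    ∃ a b : E, a + t₁ • b ∈ S₁ ∧ a + t₂ • b ∈ S₂ ∧ a + t₃ • b ∈ S₃ ∧ a + t₄ • b ∈ S₄ := by
  -- the defects of `x₂` and `x₄` from the line through `x₁` and `x₃` are the components of `Φ`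
  have hd : t₃ - t₁ ≠ 0 := (sub_pos.2 h₁₃).ne'
  let P : (E × E) × (E × E) →L[ℝ] E := .fst ℝ _ _ ∘L .fst ℝ _ _
  let Q : (E × E) × (E × E) →L[ℝ] E := .snd ℝ _ _ ∘L .fst ℝ _ _
  let R : (E × E) × (E × E) →L[ℝ] E := .fst ℝ _ _ ∘L .snd ℝ _ _
  let T : (E × E) × (E × E) →L[ℝ] E := .snd ℝ _ _ ∘L .snd ℝ _ _
  let V : (E × E) × (E × E) →L[ℝ] E := (t₃ - t₁)⁻¹ • (R - P)
  let Φ : (E × E) × (E × E) →L[ℝ] E × E :=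
    (Q - P - (t₂ - t₁) • V).prod (T - P - (t₄ - t₁) • V)
  let K : Set ((E × E) × (E × E)) := (S₁ ×ˢ S₂) ×ˢ (S₃ ×ˢ S₄)
  by_cases h0 : (0 : E × E) ∈ Φ '' K
  · obtain ⟨⟨⟨x₁, x₂⟩, x₃, x₄⟩, ⟨⟨hx₁, hx₂⟩, hx₃, hx₄⟩, hΦ⟩ := h0
    have e₂ : x₂ - x₁ - (t₂ - t₁) • (t₃ - t₁)⁻¹ • (x₃ - x₁) = 0 := congrArg Prod.fst hΦ
    have e₄ : x₄ - x₁ - (t₄ - t₁) • (t₃ - t₁)⁻¹ • (x₃ - x₁) = 0 := congrArg Prod.snd hΦ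
    refine ⟨x₁ - t₁ • (t₃ - t₁)⁻¹ • (x₃ - x₁), (t₃ - t₁)⁻¹ • (x₃ - x₁), ?_, ?_, ?_, ?_⟩
    · simpa using hx₁
    · convert hx₂ using 1
      rw [← sub_eq_zero, ← neg_eq_zero, ← e₂]; module
    · convert hx₃ using 1
      have : (t₃ - t₁) • (t₃ - t₁)⁻¹ • (x₃ - x₁) = x₃ - x₁ := by
        rw [smul_smul, mul_inv_cancel₀ hd, one_smul]
      rw [← sub_eq_zero, ← sub_eq_zero.2 this]; module
    · convert hx₄ using 1
      rw [← sub_eq_zero, ← neg_eq_zero, ← e₄]; module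
  · exfalso
    have hKc : IsCompact (Φ '' K) := ((c₁.prod c₂).prod (c₃.prod c₄)).image Φ.continuous
    have hKv : Convex ℝ (Φ '' K) :=
      ((v₁.prod v₂).prod (v₃.prod v₄)).linear_image (Φ : _ →ₗ[ℝ] E × E)
    obtain ⟨f, s, hs, hfs⟩ := geometric_hahn_banach_point_closed hKv hKc.isClosed h0
    rw [map_zero] at hs
    -- `f` is positive on the image. Starting at a minimum of `f (0, ·)` on `S₁`, go along one line
    -- to `S₃`, then along a second line through that point back to `S₁` and on to `S₄`. The defect
    -- at `S₂` vanishes, so `f` sees only the defect at `S₄`.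
    obtain ⟨x₁, hx₁, hmax⟩ := c₁.exists_isMinOn hne
      (f.comp (ContinuousLinearMap.inr ℝ E E)).continuous.continuousOn
    obtain ⟨a, b, rfl, hx₂, hx₃⟩ := hf _ hx₁
    obtain ⟨a', b', he, hx₁', hx₄⟩ := hg _ hx₃
    have key := hfs _ (mem_image_of_mem Φ
      (show ((a + t₁ • b, a + t₂ • b), (a + t₃ • b, a' + t₄ • b')) ∈ K from
        ⟨⟨hx₁, hx₂⟩, hx₃, hx₄⟩))
    have hΦ : Φ ((a + t₁ • b, a + t₂ • b), (a + t₃ • b, a' + t₄ • b')) =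
        (0, (a' + t₄ • b') - (a + t₄ • b)) := by
      have hV : (t₃ - t₁)⁻¹ • ((a + t₃ • b) - (a + t₁ • b)) = b := by
        rw [show (a + t₃ • b) - (a + t₁ • b) = (t₃ - t₁) • b by module, smul_smul,
          inv_mul_cancel₀ hd, one_smul]
      change ((a + t₂ • b) - (a + t₁ • b) - (t₂ - t₁) • (t₃ - t₁)⁻¹ • ((a + t₃ • b) - (a + t₁ • b)),
        (a' + t₄ • b') - (a + t₁ • b) - (t₄ - t₁) • (t₃ - t₁)⁻¹ • ((a + t₃ • b) - (a + t₁ • b))) = _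
      rw [hV]
      congr 1 <;> module
    rw [hΦ] at key
    have hm : f (0, a + t₁ • b) ≤ f (0, a' + t₁ • b') := hmax hx₁'
    have hlin : ∀ x y : E, ∀ c : ℝ, f (0, x + c • y) = f (0, x) + c * f (0, y) := fun x y c => by
      have : ((0, x + c • y) : E × E) = (0, x) + c • (0, y) := by simp
      rw [this, map_add, map_smul, smul_eq_mul]
    have hsub : ∀ x y : E, f (0, x - y) = f (0, x) - f (0, y) := fun x y => by
      rw [← map_sub]; simp
    have he' := congrArg (fun x => f (0, x)) he
    simp only [hsub, hlin] at key hm he'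
    -- The two lines cross at height `t₃`, so their gaps at `t₄` and at `t₁` are multiples of `b' -
    -- b` of opposite signs; a positive gap at `t₄` puts the new point of `S₁` below the minimum.
    nlinarith [mul_pos (sub_pos.2 h₁₃) (hs.trans key), mul_nonneg (sub_pos.2 h₃₄).le (sub_nonneg.2 hm)]

/-! ### Horizontal sections of the body in affine coordinates. -/

/-- The point of the plane `z = t` over the point `x` of the `(x, y)`-plane. -/
def lift (x : E2) (t : ℝ) : E3 := !₂[x 0, x 1, t]

@[simp] theorem lift_two (x : E2) (t : ℝ) : lift x t 2 = t := rfl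

@[simp] theorem proj_lift (x : E2) (t : ℝ) : proj (lift x t) = x := by
  ext i; fin_cases i <;> rfl

theorem lift_proj (p : E3) : lift (proj p) (p 2) = p := by
  ext i; fin_cases i <;> rfl

/-- The projection of the section of `𝔹` by the plane `z = t`. -/
def planarSection (𝔹 : Set RP3) (t : ℝ) : Set E2 := {x | chart (lift x t) ∈ 𝔹}

theorem mem_horizontalSection_iff {𝔹 : Set RP3} {t : ℝ} {p : E3} :
    p ∈ horizontalSection 𝔹 t ↔ p 2 = t ∧ proj p ∈ planarSection 𝔹 t := by
  constructor
  · rintro ⟨h, h'⟩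
    refine ⟨h, ?_⟩
    subst h
    simpa [planarSection, lift_proj] using h'
  · rintro ⟨h, h'⟩
    refine ⟨h, ?_⟩
    subst h
    simpa [planarSection, lift_proj] using h'

theorem lift_mem_horizontalSection {𝔹 : Set RP3} {t : ℝ} {x : E2} (hx : x ∈ planarSection 𝔹 t) :
    lift x t ∈ horizontalSection 𝔹 t :=
  mem_horizontalSection_iff.2 ⟨rfl, by simpa using hx⟩

theorem proj_image_horizontalSection (𝔹 : Set RP3) (t : ℝ) :
    proj '' horizontalSection 𝔹 t = planarSection 𝔹 t := by
  ext x
  constructor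
  · rintro ⟨p, hp, rfl⟩
    exact (mem_horizontalSection_iff.1 hp).2
  · exact fun hx => ⟨_, lift_mem_horizontalSection hx, proj_lift _ _⟩

/-- The linear form with kernel the cone over the plane `z = t`. -/
def levelForm (t : ℝ) : V4 →ₗ[ℝ] ℝ := LinearMap.proj 2 - t • LinearMap.proj 3

theorem levelForm_apply (t : ℝ) (v : V4) : levelForm t v = v 2 - t * v 3 := rfl

/-- The cone over the plane `z = t`. -/
def levelPlane (t : ℝ) : Submodule ℝ V4 := LinearMap.ker (levelForm t)

theorem mem_levelPlane {t : ℝ} {v : V4} : v ∈ levelPlane t ↔ v 2 = t * v 3 := by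
  rw [levelPlane, LinearMap.mem_ker, levelForm_apply, sub_eq_zero]

theorem finrank_levelPlane (t : ℝ) : finrank ℝ (levelPlane t) = 3 := by
  have h := (levelForm t).finrank_range_add_finrank_ker
  have hs : LinearMap.range (levelForm t) = ⊤ := by
    refine LinearMap.range_eq_top.2 fun y => ⟨![0, 0, y, 0], ?_⟩
    simp [levelForm_apply]
  rw [hs, finrank_top] at h
  simp only [finrank_self, finrank_fin_fun] at h
  change finrank ℝ (LinearMap.ker (levelForm t)) = 3
  lia

theorem infiniteLine_le_levelPlane (t : ℝ) : infiniteLine ≤ levelPlane t := by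
  rintro v ⟨h2, h3⟩
  rw [mem_levelPlane, h2, h3, mul_zero]

theorem levelPlane_injective : Function.Injective levelPlane := by
  intro s t h
  have : (![0, 0, s, 1] : V4) ∈ levelPlane t := h ▸ mem_levelPlane.2 (by simp)
  simpa using mem_levelPlane.1 this

/-- Homogeneous coordinates of the point of the plane `z = t` over `x`. -/
def homogeneous (x : E2) (t : ℝ) : V4 := ![x 0, x 1, t, 1]

theorem homogeneous_ne_zero (x : E2) (t : ℝ) : homogeneous x t ≠ 0 :=
  fun h => by simpa [homogeneous] using congrFun h 3

theorem homogeneous_mem_levelPlane (x : E2) (t : ℝ) : homogeneous x t ∈ levelPlane t :=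
  mem_levelPlane.2 (by simp [homogeneous])

theorem mem_planarSection_iff {𝔹 : Set RP3} {t : ℝ} {x : E2} :
    x ∈ planarSection 𝔹 t ↔
      Projectivization.mk ℝ (homogeneous x t) (homogeneous_ne_zero x t) ∈ 𝔹 := Iff.rfl

theorem mk_mem_projPoints_iff {W : Submodule ℝ V4} {v : V4} (hv : v ≠ 0) :
    Projectivization.mk ℝ v hv ∈ projPoints W ↔ v ∈ W := by
  rw [projPoints, mem_ofPred_eq, Projectivization.submodule_mk, Submodule.span_singleton_le_iff_mem]

variable {𝔹 : Set RP3}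

/-- A point of `𝔹` in the cone over the plane `z = t` lies in the affine chart. -/
theorem IsConvexConcave.exists_planarSection (h𝔹 : IsConvexConcave infiniteLine 𝔹) {t : ℝ} {v : V4}
    (hv : v ≠ 0) (hvt : v ∈ levelPlane t) (hvB : Projectivization.mk ℝ v hv ∈ 𝔹) :
    v 3 ≠ 0 ∧ homogeneous !₂[v 0 / v 3, v 1 / v 3] t = (v 3)⁻¹ • v ∧
      !₂[v 0 / v 3, v 1 / v 3] ∈ planarSection 𝔹 t := by
  have h2 := mem_levelPlane.1 hvt
  have h3 : v 3 ≠ 0 := by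
    intro h3
    refine Set.disjoint_left.1 h𝔹.disjoint hvB ((mk_mem_projPoints_iff hv).2 ⟨?_, h3⟩)
    rw [h2, h3, mul_zero]
  have he : homogeneous !₂[v 0 / v 3, v 1 / v 3] t = (v 3)⁻¹ • v := by
    ext i
    fin_cases i <;> simp [homogeneous, h2, h3] <;> field_simp
  refine ⟨h3, he, mem_planarSection_iff.2 ?_⟩
  convert hvB using 1
  rw [Projectivization.mk_eq_mk_iff']
  exact ⟨(v 3)⁻¹, he.symm⟩

/-- Closedness in projective space gives a compact set of unit vectors in the cone over the plane.
Since the body misses the infinite line, the last coordinate does not vanish there, and dividing by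
it is continuous. -/
theorem IsConvexConcave.isCompact_planarSection (h𝔹 : IsConvexConcave infiniteLine 𝔹) (t : ℝ) :
    IsCompact (planarSection 𝔹 t) := by
  obtain ⟨C, hC, hCe⟩ := isClosed_induced_iff.1 h𝔹.isClosed
  have hCmem : ∀ v : V4, ∀ hv : v ≠ 0, v ∈ C ↔ Projectivization.mk ℝ v hv ∈ 𝔹 := fun v hv =>
    Set.ext_iff.1 hCe ⟨v, hv⟩
  have hK : IsCompact (Metric.sphere (0 : V4) 1 ∩ (C ∩ levelPlane t)) :=
    (isCompact_sphere _ _).inter_right (hC.inter (levelPlane t).closed_of_finiteDimensional)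
  have hne : ∀ v ∈ Metric.sphere (0 : V4) 1, v ≠ 0 := fun v hv =>
    ne_zero_of_mem_unit_sphere ⟨v, hv⟩
  have himg : planarSection 𝔹 t = (fun v : V4 => (!₂[v 0 / v 3, v 1 / v 3] : E2)) ''
      (Metric.sphere (0 : V4) 1 ∩ (C ∩ levelPlane t)) := by
    ext x
    constructor
    · intro hx
      have h0 : ‖homogeneous x t‖ ≠ 0 := norm_ne_zero_iff.2 (homogeneous_ne_zero x t)
      have hv : ‖homogeneous x t‖⁻¹ • homogeneous x t ≠ 0 :=
        smul_ne_zero (inv_ne_zero h0) (homogeneous_ne_zero x t)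
      refine ⟨‖homogeneous x t‖⁻¹ • homogeneous x t, ⟨?_, ?_, ?_⟩, ?_⟩
      · simp [norm_smul, h0]
      · rw [hCmem _ hv]
        convert mem_planarSection_iff.1 hx using 1
        rw [Projectivization.mk_eq_mk_iff']
        exact ⟨_, rfl⟩
      · exact (levelPlane t).smul_mem _ (homogeneous_mem_levelPlane x t)
      · ext i
        fin_cases i <;> simp [homogeneous] <;> field_simp
    · rintro ⟨v, ⟨hv, hvC, hvt⟩, rfl⟩
      exact (h𝔹.exists_planarSection (hne v hv) hvt ((hCmem v _).1 hvC)).2.2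
  rw [himg]
  refine hK.image_of_continuousOn ?_
  have h3 : ∀ v ∈ Metric.sphere (0 : V4) 1 ∩ (C ∩ levelPlane t), v 3 ≠ 0 :=
    fun v ⟨hv, hvC, hvt⟩ => (h𝔹.exists_planarSection (hne v hv) hvt ((hCmem v _).1 hvC)).1
  refine (PiLp.continuous_toLp 2 _).comp_continuousOn (continuousOn_pi.2 fun i => ?_)
  fin_cases i
  · exact (continuous_apply 0).continuousOn.div (continuous_apply 3).continuousOn h3
  · exact (continuous_apply 1).continuousOn.div (continuous_apply 3).continuousOn h3

theorem IsConvexConcave.convex_planarSection (h𝔹 : IsConvexConcave infiniteLine 𝔹) (t : ℝ) :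
    Convex ℝ (planarSection 𝔹 t) := by
  have h := h𝔹.convex (levelPlane t) (finrank_levelPlane t) (infiniteLine_le_levelPlane t)
    (LinearMap.proj 3) (fun v hv => hv.2)
  have hmem : ∀ x, x ∈ planarSection 𝔹 t → homogeneous x t ∈ {v : V4 | v ∈ levelPlane t ∧
      (LinearMap.proj 3 : V4 →ₗ[ℝ] ℝ) v = 1 ∧ ∃ hv : v ≠ 0, Projectivization.mk ℝ v hv ∈ 𝔹} :=
    fun x hx => ⟨homogeneous_mem_levelPlane x t, by simp [homogeneous], homogeneous_ne_zero x t, hx⟩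
  intro x hx y hy a b ha hb hab
  obtain ⟨-, -, hv, hv'⟩ := h (hmem x hx) (hmem y hy) ha hb hab
  rw [mem_planarSection_iff]
  convert hv' using 2
  ext i
  fin_cases i <;> simp [homogeneous, ← add_mul, hab]

/-- Through every point of a section passes a line that meets two other given sections. -/
theorem IsConvexConcave.exists_line (h𝔹 : IsConvexConcave infiniteLine 𝔹) {r s t : ℝ}
    (hrs : r ≠ s) (hrt : r ≠ t) (hst : s ≠ t) {x : E2} (hx : x ∈ planarSection 𝔹 r) :
    ∃ a b : E2, a + r • b = x ∧ a + s • b ∈ planarSection 𝔹 s ∧ a + t • b ∈ planarSection 𝔹 t := by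
  obtain ⟨l, hl, hxl, ⟨q, hql, hqB, hqs⟩, ⟨q', hql', hqB', hqt⟩⟩ := h𝔹.lines
    (levelPlane r) (levelPlane s) (levelPlane t)
    (finrank_levelPlane r) (finrank_levelPlane s) (finrank_levelPlane t)
    (infiniteLine_le_levelPlane r) (infiniteLine_le_levelPlane s) (infiniteLine_le_levelPlane t)
    (levelPlane_injective.ne hrs) (levelPlane_injective.ne hrt) (levelPlane_injective.ne hst)
    _ ⟨mem_planarSection_iff.1 hx,
      (mk_mem_projPoints_iff _).2 (homogeneous_mem_levelPlane x r)⟩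
  have hpt : ∀ q ∈ 𝔹, ∀ s : ℝ, q ∈ projPoints (levelPlane s) → q ∈ projPoints l →
      ∃ y ∈ planarSection 𝔹 s, homogeneous y s ∈ l := by
    intro q hq s hqs hql
    induction q using Projectivization.ind with
    | h v hv =>
      rw [mk_mem_projPoints_iff] at hqs hql
      obtain ⟨-, he, hy⟩ := h𝔹.exists_planarSection hv hqs hq
      exact ⟨_, hy, he ▸ l.smul_mem _ hql⟩
  obtain ⟨y, hy, hyl⟩ := hpt q hqB s hqs hql
  obtain ⟨z, hz, hzl⟩ := hpt q' hqB' t hqt hql'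
  rw [mk_mem_projPoints_iff] at hxl
  -- the third point is a combination of the first two
  have hli : LinearIndependent ℝ ![homogeneous x r, homogeneous y s] := by
    rw [LinearIndependent.pair_iff]
    intro α β h
    have e2 := congrFun h 2
    have e3 := congrFun h 3
    simp only [homogeneous, Pi.add_apply, Pi.smul_apply, smul_eq_mul, Pi.zero_apply,
      Matrix.cons_val] at e2 e3
    have : α * (r - s) = 0 := by linear_combination e2 - s * e3
    have hα : α = 0 := (mul_eq_zero.1 this).resolve_right (sub_ne_zero.2 hrs)
    exact ⟨hα, by simpa [hα] using e3⟩
  have hspan : Submodule.span ℝ {homogeneous x r, homogeneous y s} = l := by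
    refine Submodule.eq_of_le_of_finrank_eq ?_ ?_
    · rw [Submodule.span_le]
      rintro _ (rfl | rfl) <;> assumption
    · rw [hl]
      have := finrank_span_eq_card hli
      rwa [Matrix.range_cons_cons_empty, Fintype.card_fin] at this
  rw [← hspan, Submodule.mem_span_pair] at hzl
  obtain ⟨α, β, h⟩ := hzl
  have e0 := congrFun h 0
  have e1 := congrFun h 1
  have e2 := congrFun h 2
  have e3 := congrFun h 3
  simp only [homogeneous, Pi.add_apply, Pi.smul_apply, smul_eq_mul,
      Matrix.cons_val] at e0 e1 e2 e3
  have hd : s - r ≠ 0 := sub_ne_zero.2 hrs.symm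
  -- The last two coordinates alone determine the barycentric coefficients.
  have hβ : β = (t - r) * (s - r)⁻¹ := by
    rw [eq_mul_inv_iff_mul_eq₀ hd]; linear_combination e2 - r * e3
  have hα : α = 1 - (t - r) * (s - r)⁻¹ := by rw [← hβ]; linear_combination e3
  refine ⟨x - r • (s - r)⁻¹ • (y - x), (s - r)⁻¹ • (y - x), by simp, ?_, ?_⟩
  · convert hy using 1
    have : (s - r) • (s - r)⁻¹ • (y - x) = y - x := by
      rw [smul_smul, mul_inv_cancel₀ hd, one_smul]
    rw [← sub_eq_zero, ← sub_eq_zero.2 this]; module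
  · convert hz using 1
    ext i
    fin_cases i
    · simp [← e0, hα, hβ]; ring
    · simp [← e1, hα, hβ]; ring

/-! ### Half-planes -/

theorem inner_eq (u x : E2) : ⟪u, x⟫_ℝ = u 0 * x 0 + u 1 * x 1 := by
  simp [PiLp.inner_apply, Fin.sum_univ_two, mul_comm]

theorem proj_image_halfPlane (u : E2) (t : ℝ) : proj '' halfPlane u t = {x | 0 ≤ ⟪u, x⟫_ℝ} := by
  ext x
  constructor
  · rintro ⟨p, hp, rfl⟩
    exact hp.2
  · intro hx
    exact ⟨lift x t, ⟨rfl, by simpa using hx⟩, proj_lift _ _⟩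

/-- A surjective continuous linear form is open, so interior, frontier and closure of half-planes
can be computed on the real line and pulled back. -/
theorem surjective_innerSL {u : E2} (hu : u ≠ 0) : Function.Surjective (innerSL ℝ u) := by
  intro y
  refine ⟨(y / ⟪u, u⟫_ℝ) • u, ?_⟩
  have : ⟪u, u⟫_ℝ ≠ 0 := inner_self_ne_zero.2 hu
  rw [innerSL_apply_apply, inner_smul_right, div_mul_cancel₀ _ this]

theorem mem_interior_proj_halfPlane {u : E2} (hu : u ≠ 0) {t : ℝ} {x : E2} :
    x ∈ interior (proj '' halfPlane u t) ↔ 0 < ⟪u, x⟫_ℝ := by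
  have := (innerSL ℝ u).interior_preimage (surjective_innerSL hu) (Ici 0)
  rw [interior_Ici] at this
  rw [proj_image_halfPlane]
  exact Set.ext_iff.1 this x

theorem mem_frontier_proj_halfPlane {u : E2} (hu : u ≠ 0) {t : ℝ} {x : E2} :
    x ∈ frontier (proj '' halfPlane u t) ↔ ⟪u, x⟫_ℝ = 0 := by
  have := (innerSL ℝ u).frontier_preimage (surjective_innerSL hu) (Ici 0)
  rw [frontier_Ici] at this
  rw [proj_image_halfPlane]
  exact Set.ext_iff.1 this x

theorem mem_projCompl_halfPlane {u : E2} (hu : u ≠ 0) {t : ℝ} {x : E2} :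
    x ∈ projCompl (halfPlane u t) ↔ ⟪u, x⟫_ℝ ≤ 0 := by
  have := (innerSL ℝ u).closure_preimage (surjective_innerSL hu) (Iio 0)
  rw [closure_Iio] at this
  rw [projCompl, proj_image_halfPlane]
  have hc : {x : E2 | 0 ≤ ⟪u, x⟫_ℝ}ᶜ = innerSL ℝ u ⁻¹' Iio 0 := by ext y; simp
  rw [hc]
  exact Set.ext_iff.1 this x

theorem mem_halfSpace_halfPlane {u : E2} {t : ℝ} {p : E3} :
    p ∈ halfSpace (halfPlane u t) ↔ 0 ≤ ⟪u, proj p⟫_ℝ := by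
  rw [halfSpace, proj_image_halfPlane]; rfl

/-- The projection along the `z`-axis as a continuous linear map. -/
noncomputable def projL : E3 →L[ℝ] E2 :=
  LinearMap.toContinuousLinearMap
    { toFun := proj
      map_add' := fun p q => by ext i; fin_cases i <;> rfl
      map_smul' := fun c p => by ext i; fin_cases i <;> rfl }

theorem projL_apply (p : E3) : projL p = proj p := rfl

theorem mem_halfSpaceCompl_halfPlane {u : E2} (hu : u ≠ 0) {t : ℝ} {p : E3} :
    p ∈ halfSpaceCompl (halfPlane u t) ↔ ⟪u, proj p⟫_ℝ ≤ 0 := by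
  have := projL.closure_preimage (fun x => ⟨lift x 0, proj_lift x 0⟩) (proj '' halfPlane u t)ᶜ
  rw [← mem_projCompl_halfPlane hu (t := t)]
  exact Set.ext_iff.1 this p

/-! ### Linear relations between normals -/

theorem det2_ne_zero {u v : E2} (h : LinearIndependent ℝ ![u, v]) : det2 u v ≠ 0 := by
  intro h0
  rw [LinearIndependent.pair_iff] at h
  have h0' : u 0 * v 1 - u 1 * v 0 = 0 := h0
  have e₁ := h (v 1) (-u 1) (by
    ext i; fin_cases i <;> simp <;> linarith)
  have e₂ := h (v 0) (-u 0) (by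
    ext i; fin_cases i <;> simp <;> linarith)
  have := h 1 0 (by
    ext i; fin_cases i
    · simpa using e₂.2
    · simpa using e₁.2)
  exact one_ne_zero this.1

theorem det2_swap (u v : E2) : det2 u v = -det2 v u := by simp only [det2]; ring

theorem inner_boundaryDir (u v : E2) : ⟪u, boundaryDir v⟫_ℝ = -det2 u v := by
  simp [inner_eq, boundaryDir, det2]; ring

theorem det2_boundaryDir (u v : E2) : det2 (boundaryDir u) (boundaryDir v) = det2 u v := by
  simp [boundaryDir, det2]; ring

theorem det2_neg_right (u v : E2) : det2 u (-v) = -det2 u v := by simp [det2]; ring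

theorem det2_neg_left (u v : E2) : det2 (-u) v = -det2 u v := by simp [det2]; ring

/-- Cramer's rule: the linear dependence between three vectors of the plane. -/
theorem det2_smul_eq (u v w : E2) : det2 u v • w = det2 w v • u + det2 u w • v := by
  ext i; fin_cases i <;> simp [det2] <;> ring

/-- If the sector of two half-planes lies in a third half-plane, then the third normal is a
positive combination of the first two. -/
theorem exists_pos_combination {u v w : E2} (huv : det2 u v ≠ 0) (huw : det2 u w ≠ 0)
    (hvw : det2 v w ≠ 0) (h : ∀ x, 0 ≤ ⟪u, x⟫_ℝ → 0 ≤ ⟪v, x⟫_ℝ → 0 ≤ ⟪w, x⟫_ℝ) :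
    ∃ a b : ℝ, 0 < a ∧ 0 < b ∧ ∀ x, ⟪w, x⟫_ℝ = a * ⟪u, x⟫_ℝ + b * ⟪v, x⟫_ℝ := by
  have hwv : det2 w v ≠ 0 := by rw [det2_swap]; exact neg_ne_zero.2 hvw
  have self : ∀ u, det2 u u = 0 := fun u => by simp only [det2]; ring
  refine ⟨det2 w v / det2 u v, det2 u w / det2 u v, lt_of_le_of_ne ?_ (div_ne_zero hwv huv).symm,
    lt_of_le_of_ne ?_ (div_ne_zero huw huv).symm, fun x => ?_⟩
  -- The coefficients come from Cramer's rule. Testing on the basis dual to `u`, `v`, whose vectors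
  -- span the edges of the sector, shows that they are non-negative.
  · have := h ((-(det2 u v)⁻¹) • boundaryDir v)
    simp only [inner_smul_right, inner_boundaryDir, self, neg_mul_neg, inv_mul_cancel₀ huv] at this
    simpa [div_eq_inv_mul] using this
  · have := h ((det2 u v)⁻¹ • boundaryDir u)
    simp only [inner_smul_right, inner_boundaryDir, self, det2_swap v u, det2_swap w u, neg_neg,
      inv_mul_cancel₀ huv] at this
    simpa [div_eq_inv_mul] using this
  · have := congrArg (fun y => ⟪y, x⟫_ℝ) (det2_smul_eq u v w)
    simp only [inner_add_left, real_inner_smul_left] at this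
    field_simp
    linarith

/-- The relations between the normals `u₁, …, u₄` that the two combinatorial conditions amount
to. -/
def SignRelations (u₁ u₂ u₃ u₄ : E2) : Prop :=
  ∃ a b c d : ℝ, 0 < a ∧ 0 < b ∧ 0 < c ∧ 0 < d ∧
    (∀ x, ⟪u₂, x⟫_ℝ = -a * ⟪u₁, x⟫_ℝ + b * ⟪u₄, x⟫_ℝ) ∧
    ∀ x, ⟪u₄, x⟫_ℝ = -c * ⟪u₃, x⟫_ℝ - d * ⟪u₂, x⟫_ℝ

/-- Each inclusion is a planar Farkas statement, applied to `u₁`, `-u₄`, `-u₂` and to `u₃`, `u₂`,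
`-u₄`. -/
theorem signRelations_of_sectors {u₁ u₂ u₃ u₄ : E2} (h₁₂ : det2 u₁ u₂ ≠ 0) (h₁₄ : det2 u₁ u₄ ≠ 0)
    (h₂₃ : det2 u₃ u₂ ≠ 0) (h₂₄ : det2 u₂ u₄ ≠ 0) (h₃₄ : det2 u₃ u₄ ≠ 0)
    (hs : ∀ x, 0 ≤ ⟪u₁, x⟫_ℝ → ⟪u₄, x⟫_ℝ ≤ 0 → ⟪u₂, x⟫_ℝ ≤ 0)
    (hs' : ∀ x, 0 ≤ ⟪u₃, x⟫_ℝ → 0 ≤ ⟪u₂, x⟫_ℝ → ⟪u₄, x⟫_ℝ ≤ 0) : SignRelations u₁ u₂ u₃ u₄ := by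
  have h₄₂ : det2 u₄ u₂ ≠ 0 := by rw [det2_swap]; exact neg_ne_zero.2 h₂₄
  obtain ⟨a, b, ha, hb, hab⟩ := exists_pos_combination (u := u₁) (v := -u₄) (w := -u₂)
    (by simpa [det2_neg_right] using h₁₄) (by simpa [det2_neg_right] using h₁₂)
    (by simpa [det2_neg_right, det2_neg_left] using h₄₂)
    (fun x => by simpa only [inner_neg_left, Left.nonneg_neg_iff] using hs x)
  obtain ⟨c, d, hc, hd, hcd⟩ := exists_pos_combination (u := u₃) (v := u₂) (w := -u₄) h₂₃
    (by simpa [det2_neg_right] using h₃₄) (by simpa [det2_neg_right] using h₂₄)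
    (fun x => by simpa only [inner_neg_left, Left.nonneg_neg_iff] using hs' x)
  simp only [inner_neg_left] at hab hcd
  exact ⟨a, b, c, d, ha, hb, hc, hd, fun x => by linarith [hab x], fun x => by linarith [hcd x]⟩

/-! ### Codes -/

/-- The unit vector in the direction of motion at the point of the circle with polar angle `φ`, for
the orientation `ε = ±1`. -/
noncomputable def circleTangent (φ ε : ℝ) : E2 := !₂[-(ε * Real.sin φ), ε * Real.cos φ]

theorem circlePoint_add {ε : ℝ} (hε : ε = 1 ∨ ε = -1) (φ θ : ℝ) :
    circlePoint (φ + ε * θ) = Real.cos θ • circlePoint φ + Real.sin θ • circleTangent φ ε := by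
  ext i
  rcases hε with rfl | rfl <;> fin_cases i <;>
    simp [circlePoint, circleTangent, Real.cos_add, Real.sin_add] <;> ring

theorem exists_eq_smul_add_smul {ε : ℝ} (hε : ε = 1 ∨ ε = -1) (φ : ℝ) (x : E2) :
    ∃ α β : ℝ, x = α • circlePoint φ + β • circleTangent φ ε := by
  have h := Real.sin_sq_add_cos_sq φ
  have he : ε ^ 2 = 1 := by rcases hε with rfl | rfl <;> norm_num
  refine ⟨⟪x, circlePoint φ⟫_ℝ, ⟪x, circleTangent φ ε⟫_ℝ, ?_⟩
  ext i
  fin_cases i <;> simp [inner_eq, circlePoint, circleTangent]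
  · linear_combination (-x 0) * h + (x 1 * Real.cos φ * Real.sin φ - x 0 * Real.sin φ ^ 2) * he
  · linear_combination (-x 1) * h + (x 0 * Real.cos φ * Real.sin φ - x 1 * Real.cos φ ^ 2) * he

/-- A linear form on the tangent vector, divided by its value at the base point. -/
noncomputable def slope (φ ε : ℝ) (u : E2) : ℝ :=
  ⟪u, circleTangent φ ε⟫_ℝ / ⟪u, circlePoint φ⟫_ℝ

theorem inner_smul_add_smul {φ : ℝ} (ε : ℝ) {u : E2} (hu : ⟪u, circlePoint φ⟫_ℝ ≠ 0) (α β : ℝ) :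
    ⟪u, α • circlePoint φ + β • circleTangent φ ε⟫_ℝ =
      ⟪u, circlePoint φ⟫_ℝ * (α + β * slope φ ε u) := by
  rw [inner_add_right, inner_smul_right, inner_smul_right, slope]
  field_simp

/-- The slope is `-cot θ`, which increases on `(0, π)`. Hence meeting the lines in order around the
half circle is the same as ordering their slopes. -/
theorem slope_eq_tan {φ ε θ : ℝ} (hε : ε = 1 ∨ ε = -1) {u : E2} (hu : ⟪u, circlePoint φ⟫_ℝ ≠ 0)
    (hθ : 0 < θ) (hθ' : θ < Real.pi) (h : ⟪u, circlePoint (φ + ε * θ)⟫_ℝ = 0) :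
    slope φ ε u = Real.tan (θ - Real.pi / 2) := by
  rw [circlePoint_add hε, inner_smul_add_smul ε hu] at h
  have h' := (mul_eq_zero.1 h).resolve_left hu
  rw [Real.tan_eq_sin_div_cos, Real.sin_sub_pi_div_two, Real.cos_sub_pi_div_two,
    eq_div_iff (Real.sin_pos_of_pos_of_lt_pi hθ hθ').ne']
  linarith

theorem inner_circlePoint_arctan_slope {φ ε : ℝ} (hε : ε = 1 ∨ ε = -1) {u : E2}
    (hu : ⟪u, circlePoint φ⟫_ℝ ≠ 0) :
    ⟪u, circlePoint (φ + ε * (Real.arctan (slope φ ε u) + Real.pi / 2))⟫_ℝ = 0 := by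
  rw [circlePoint_add hε, inner_smul_add_smul ε hu, Real.cos_add_pi_div_two,
    Real.sin_add_pi_div_two]
  have h := Real.tan_arctan (slope φ ε u)
  rw [Real.tan_eq_sin_div_cos, div_eq_iff (Real.cos_arctan_pos _).ne'] at h
  rw [h]; ring

/-- In the basis of base point and tangent, each form is its value at the base point times `α + β *
slope`. Both inclusions thus become statements about one affine function of the slope. -/
theorem sectors_of_slopes {φ ε : ℝ} (hε : ε = 1 ∨ ε = -1) {u₁ u₂ u₃ u₄ : E2}
    (h₁ : 0 < ⟪u₁, circlePoint φ⟫_ℝ) (h₂ : ⟪u₂, circlePoint φ⟫_ℝ < 0)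
    (h₃ : 0 < ⟪u₃, circlePoint φ⟫_ℝ) (h₄ : ⟪u₄, circlePoint φ⟫_ℝ < 0)
    (h₁₂ : slope φ ε u₁ < slope φ ε u₂) (h₂₃ : slope φ ε u₂ < slope φ ε u₃)
    (h₃₄ : slope φ ε u₃ < slope φ ε u₄) :
    (∀ x, 0 ≤ ⟪u₁, x⟫_ℝ → ⟪u₄, x⟫_ℝ ≤ 0 → ⟪u₂, x⟫_ℝ ≤ 0) ∧
    (∀ x, 0 ≤ ⟪u₃, x⟫_ℝ → 0 ≤ ⟪u₂, x⟫_ℝ → ⟪u₄, x⟫_ℝ ≤ 0) := by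
  constructor <;> intro x <;> obtain ⟨α, β, rfl⟩ := exists_eq_smul_add_smul hε φ x
  · rw [inner_smul_add_smul ε h₁.ne', inner_smul_add_smul ε h₂.ne, inner_smul_add_smul ε h₄.ne]
    intro k₁ k₄
    have k₁' := nonneg_of_mul_nonneg_right k₁ h₁
    have k₄' : 0 ≤ α + β * slope φ ε u₄ := by by_contra! hc; nlinarith
    refine mul_nonpos_of_nonpos_of_nonneg h₂.le ?_
    -- An affine function that is non-negative at the slopes of `u₁` and `u₄` is so in between,
    -- whether it rises or falls.
    rcases le_total 0 β with hβ | hβ <;> nlinarith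
  · rw [inner_smul_add_smul ε h₃.ne', inner_smul_add_smul ε h₂.ne, inner_smul_add_smul ε h₄.ne]
    intro k₃ k₂
    have k₃' := nonneg_of_mul_nonneg_right k₃ h₃
    have k₂' : α + β * slope φ ε u₂ ≤ 0 := by by_contra! hc; nlinarith
    refine mul_nonpos_of_nonpos_of_nonneg h₄.le ?_
    -- The affine function does not decrease from the second slope to the third, so it remains
    -- non-negative at the fourth.
    have hβ : 0 ≤ β := by by_contra! hc; nlinarith
    nlinarith

theorem sectors_of_isCode {m : ℕ} {u : Fin m → E2} (hu : ∀ i, u i ≠ 0) {t : Fin m → ℝ}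
    {i₁ i₂ i₃ i₄ : Fin m} {φ ε : ℝ} {c : List (Fin m × Bool)}
    (hc : IsCode (fun i => proj '' halfPlane (u i) (t i)) φ ε c)
    (hsub : [(i₁, true), (i₂, false), (i₃, true), (i₄, false)].Sublist c) :
    (∀ x, 0 ≤ ⟪u i₁, x⟫_ℝ → ⟪u i₄, x⟫_ℝ ≤ 0 → ⟪u i₂, x⟫_ℝ ≤ 0) ∧
    (∀ x, 0 ≤ ⟪u i₃, x⟫_ℝ → 0 ≤ ⟪u i₂, x⟫_ℝ → ⟪u i₄, x⟫_ℝ ≤ 0) := by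
  obtain ⟨θ, hθ, hpw⟩ := hc.order
  have hbase : ∀ i, ⟪u i, circlePoint φ⟫_ℝ ≠ 0 := fun i h =>
    hc.base i ((mem_frontier_proj_halfPlane (hu i)).2 h)
  have hpos : ∀ i, (i, true) ∈ c → 0 < ⟪u i, circlePoint φ⟫_ℝ := fun i hi => by
    have : circlePoint φ ∈ proj '' halfPlane (u i) (t i) := (hc.sign _ hi).1 rfl
    rw [proj_image_halfPlane] at this
    exact lt_of_le_of_ne this (hbase i).symm
  have hneg : ∀ i, (i, false) ∈ c → ⟪u i, circlePoint φ⟫_ℝ < 0 := fun i hi => by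
    have : ¬ circlePoint φ ∈ proj '' halfPlane (u i) (t i) := fun h => by
      simpa using (hc.sign _ hi).2 h
    rw [proj_image_halfPlane] at this
    exact not_le.1 this
  have hlt : ∀ i j, θ i < θ j → slope φ ε (u i) < slope φ ε (u j) := fun i j hij => by
    obtain ⟨a, b, d⟩ := hθ i
    obtain ⟨a', b', d'⟩ := hθ j
    rw [slope_eq_tan hc.orientation (hbase i) a b ((mem_frontier_proj_halfPlane (hu i)).1 d),
      slope_eq_tan hc.orientation (hbase j) a' b' ((mem_frontier_proj_halfPlane (hu j)).1 d')]
    exact Real.tan_lt_tan_of_lt_of_lt_pi_div_two (by linarith) (by linarith) (by linarith)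
  have hp := hpw.sublist hsub
  simp only [List.pairwise_cons, List.mem_cons, forall_eq_or_imp] at hp
  have hmem := hsub.subset
  exact sectors_of_slopes hc.orientation (hpos _ (hmem (by simp))) (hneg _ (hmem (by simp)))
    (hpos _ (hmem (by simp))) (hneg _ (hmem (by simp))) (hlt _ _ hp.1.1) (hlt _ _ hp.2.1.1)
    (hlt _ _ hp.2.2.1.1)

/-- A sector between two lines contains a point on none of finitely many further lines. -/
theorem exists_generic_in_sector {m : ℕ} {u : Fin m → E2} (hu : ∀ i, u i ≠ 0) {v w : E2}
    (hvw : det2 v w ≠ 0) :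
    ∃ x, 0 < ⟪v, x⟫_ℝ ∧ ⟪w, x⟫_ℝ < 0 ∧ ∀ i, ⟪u i, x⟫_ℝ ≠ 0 := by
  obtain ⟨e, he, he'⟩ : ∃ e, ⟪v, e⟫_ℝ = 1 ∧ ⟪w, e⟫_ℝ = 0 :=
    ⟨(-(det2 v w)⁻¹) • boundaryDir w, by
      simp [inner_smul_right, inner_boundaryDir, hvw], by
      simp [inner_smul_right, inner_boundaryDir, det2, mul_comm]⟩
  obtain ⟨f, hf, hf'⟩ : ∃ f, ⟪v, f⟫_ℝ = 0 ∧ ⟪w, f⟫_ℝ = -1 :=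
    ⟨(-(det2 v w)⁻¹) • boundaryDir v, by
      simp [inner_smul_right, inner_boundaryDir, det2, mul_comm], by
      simp [inner_smul_right, inner_boundaryDir, det2_swap w v, hvw]⟩
  have hnz : ∀ i, ⟪u i, f⟫_ℝ = 0 → ⟪u i, e⟫_ℝ ≠ 0 := by
    intro i h h'
    have h2 := det2_smul_eq v w (u i)
    have k := congrArg (fun y => ⟪y, f⟫_ℝ) h2
    have k' := congrArg (fun y => ⟪y, e⟫_ℝ) h2
    simp only [inner_add_left, real_inner_smul_left, h, h', he, he', hf, hf'] at k k'
    have z₁ : det2 v (u i) = 0 := by linarith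
    have z₂ : det2 (u i) w = 0 := by linarith
    rw [z₁, z₂, zero_smul, zero_smul, add_zero] at h2
    exact hu i ((smul_eq_zero.1 h2).resolve_left hvw)
  -- On the ray `e + s • f`, a form that does not vanish on `f` excludes one value of `s`. A form
  -- that vanishes on `f` contributes the spurious value 0, but it is non-zero on the whole ray by
  -- `hnz`.
  obtain ⟨s, hs, hs'⟩ := ((Set.Ioi_infinite (0 : ℝ)).sdiff
    (Set.finite_range fun i => -⟪u i, e⟫_ℝ / ⟪u i, f⟫_ℝ)).nonempty
  refine ⟨e + s • f, ?_, ?_, fun i h => ?_⟩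
  · simp [inner_add_right, inner_smul_right, he, hf]
  · simpa [inner_add_right, inner_smul_right, he', hf'] using hs
  · rw [inner_add_right, inner_smul_right] at h
    by_cases h0 : ⟪u i, f⟫_ℝ = 0
    · exact hnz i h0 (by simpa [h0] using h)
    · exact hs' ⟨i, by rw [div_eq_iff h0]; linarith⟩

theorem exists_eq_smul_circlePoint {x : E2} (hx : x ≠ 0) :
    ∃ r φ : ℝ, 0 < r ∧ x = r • circlePoint φ := by
  let z : ℂ := ⟨x 0, x 1⟩
  have hz : z ≠ 0 := by
    intro h
    apply hx
    ext i
    fin_cases i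
    · exact congrArg Complex.re h
    · exact congrArg Complex.im h
  refine ⟨‖z‖, Complex.arg z, norm_pos_iff.2 hz, ?_⟩
  ext i
  fin_cases i
  · exact (Complex.norm_mul_cos_arg z).symm
  · exact (Complex.norm_mul_sin_arg z).symm

/-- With equal slopes the two forms would be proportional, hence vanish on the same line. -/
theorem slope_ne_slope {φ ε : ℝ} (hε : ε = 1 ∨ ε = -1) {u v : E2} (h : det2 u v ≠ 0)
    (hu : ⟪u, circlePoint φ⟫_ℝ ≠ 0) (hv : ⟪v, circlePoint φ⟫_ℝ ≠ 0) :
    slope φ ε u ≠ slope φ ε v := by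
  intro he
  obtain ⟨α, β, hb⟩ := exists_eq_smul_add_smul hε φ (boundaryDir v)
  have k : ⟪v, boundaryDir v⟫_ℝ = 0 := by rw [inner_boundaryDir]; simp [det2, mul_comm]
  have k' : ⟪u, boundaryDir v⟫_ℝ ≠ 0 := by rw [inner_boundaryDir]; exact neg_ne_zero.2 h
  rw [hb, inner_smul_add_smul ε hv] at k
  rw [hb, inner_smul_add_smul ε hu, he] at k'
  exact k' (by rw [(mul_eq_zero.1 k).resolve_left hv, mul_zero])

/-- The code of a configuration for a base point on none of the boundary lines; its entries are
ordered by their slopes. -/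
theorem exists_isCode {m : ℕ} {u : Fin m → E2} (hu : ∀ i, u i ≠ 0)
    (hdet : ∀ i j, i ≠ j → det2 (u i) (u j) ≠ 0) (t : Fin m → ℝ) {φ ε : ℝ}
    (hε : ε = 1 ∨ ε = -1) (hφ : ∀ i, ⟪u i, circlePoint φ⟫_ℝ ≠ 0) {l : List (Fin m)}
    (hl : l.Pairwise fun i j => slope φ ε (u i) < slope φ ε (u j)) :
    ∃ c, IsCode (fun i => proj '' halfPlane (u i) (t i)) φ ε c ∧
      (l.map fun i => (i, decide (0 < ⟪u i, circlePoint φ⟫_ℝ))).Sublist c := by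
  let r : Fin m → Fin m → Prop := fun i j => slope φ ε (u i) ≤ slope φ ε (u j)
  have hinj : Function.Injective fun i => slope φ ε (u i) := fun i j hij => by
    by_contra hne
    exact slope_ne_slope hε (hdet i j hne) (hφ i) (hφ j) hij
  have : DecidableRel r := Classical.decRel r
  have : Std.Total r := ⟨fun i j => le_total _ _⟩
  have : IsTrans (Fin m) r := ⟨fun i j k h h' => le_trans h h'⟩
  have : Std.Antisymm r := ⟨fun i j h h' => hinj (le_antisymm h h')⟩
  let s := (List.finRange m).insertionSort r
  have hsmem : ∀ i, i ∈ s := fun i => (List.mem_insertionSort r).2 (List.mem_finRange i)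
  have hsnd : s.Nodup := (List.perm_insertionSort r _).nodup_iff.2 (List.nodup_finRange m)
  have hspw : s.Pairwise r := List.pairwise_insertionSort r _
  -- Both lists are sorted by slope and free of repetitions, so containment of the entries already
  -- gives a sublist.
  have hls : l.Sublist s := by
    refine List.sublist_of_subperm_of_pairwise (r := r)
      (List.subperm_of_subset ?_ fun i _ => hsmem i) (hl.imp le_of_lt) hspw
    exact hl.imp fun h he => by rw [he] at h; exact lt_irrefl _ h
  refine ⟨s.map fun i => (i, decide (0 < ⟪u i, circlePoint φ⟫_ℝ)), ⟨hε, ?_, ?_, ?_, ?_⟩,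
    hls.map _⟩
  · exact fun i h => hφ i ((mem_frontier_proj_halfPlane (hu i)).1 h)
  · intro i
    rw [List.map_map]
    exact List.mem_map.2 ⟨i, hsmem i, rfl⟩
  -- The inverse of `slope_eq_tan`: this angle lies in `(0, π)` and increases with the slope.
  · refine ⟨fun i => Real.arctan (slope φ ε (u i)) + Real.pi / 2, fun i => ⟨?_, ?_, ?_⟩, ?_⟩
    · linarith [Real.neg_pi_div_two_lt_arctan (slope φ ε (u i))]
    · linarith [Real.arctan_lt_pi_div_two (slope φ ε (u i))]
    · exact (mem_frontier_proj_halfPlane (hu i)).2 (inner_circlePoint_arctan_slope hε (hφ i))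
    · rw [List.pairwise_map]
      refine (hspw.and hsnd).imp fun {i j} h => ?_
      have : slope φ ε (u i) < slope φ ε (u j) := lt_of_le_of_ne h.1 (hinj.ne h.2)
      simpa using Real.arctan_strictMono this
  · intro a ha
    obtain ⟨i, -, rfl⟩ := List.mem_map.1 ha
    rw [proj_image_halfPlane]
    simpa using ⟨le_of_lt, fun h => lt_of_le_of_ne h (hφ i).symm⟩

/-- Reversing the orientation reverses the order of the slopes; this is how the orientation of the
code gets chosen. -/
theorem slope_neg (φ ε : ℝ) (u : E2) : slope φ (-ε) u = -slope φ ε u := by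
  simp only [slope, inner_eq, circleTangent]
  simp
  ring

/-- The slope of a combination with coefficients of equal signs lies between the slopes. -/
theorem slope_between {φ ε : ℝ} {u v w : E2} {a b : ℝ}
    (hw : ∀ x, ⟪w, x⟫_ℝ = a * ⟪u, x⟫_ℝ + b * ⟪v, x⟫_ℝ)
    (hu : 0 < a * ⟪u, circlePoint φ⟫_ℝ) (hv : 0 < b * ⟪v, circlePoint φ⟫_ℝ)
    (h : slope φ ε u < slope φ ε v) : slope φ ε u < slope φ ε w ∧ slope φ ε w < slope φ ε v := by
  have hu0 : ⟪u, circlePoint φ⟫_ℝ ≠ 0 := right_ne_zero_of_mul hu.ne'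
  have hv0 : ⟪v, circlePoint φ⟫_ℝ ≠ 0 := right_ne_zero_of_mul hv.ne'
  have e₁ : ⟪u, circleTangent φ ε⟫_ℝ = slope φ ε u * ⟪u, circlePoint φ⟫_ℝ := by
    rw [slope, div_mul_cancel₀ _ hu0]
  have e₂ : ⟪v, circleTangent φ ε⟫_ℝ = slope φ ε v * ⟪v, circlePoint φ⟫_ℝ := by
    rw [slope, div_mul_cancel₀ _ hv0]
  -- The new slope is a weighted mean of the two old ones, with positive weights.
  have hw0 : slope φ ε w = (slope φ ε u * (a * ⟪u, circlePoint φ⟫_ℝ) +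
      slope φ ε v * (b * ⟪v, circlePoint φ⟫_ℝ)) /
      (a * ⟪u, circlePoint φ⟫_ℝ + b * ⟪v, circlePoint φ⟫_ℝ) := by
    rw [slope, hw, hw, e₁, e₂]
    congr 1
    ring
  rw [hw0, lt_div_iff₀ (by positivity), div_lt_iff₀ (by positivity)]
  constructor <;> nlinarith

theorem SignRelations.exists_isCode {m : ℕ} {u : Fin m → E2} (hu : ∀ i, u i ≠ 0)
    (hdet : ∀ i j, i ≠ j → det2 (u i) (u j) ≠ 0) (t : Fin m → ℝ) {i₁ i₂ i₃ i₄ : Fin m}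
    (h₁₄ : i₁ ≠ i₄) (h : SignRelations (u i₁) (u i₂) (u i₃) (u i₄)) :
    ∃ (φ ε : ℝ) (c : List (Fin m × Bool)),
      IsCode (fun i => proj '' halfPlane (u i) (t i)) φ ε c ∧
      [(i₁, true), (i₂, false), (i₃, true), (i₄, false)].Sublist c := by
  obtain ⟨x, hx₁, hx₄, hx⟩ := exists_generic_in_sector hu (hdet _ _ h₁₄)
  obtain ⟨r, φ, hr, rfl⟩ := exists_eq_smul_circlePoint (x := x) (by
    rintro rfl; simp at hx₁)
  simp only [inner_smul_right, ne_eq, mul_eq_zero, hr.ne', false_or] at hx hx₁ hx₄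
  have n₁ : 0 < ⟪u i₁, circlePoint φ⟫_ℝ := pos_of_mul_pos_right hx₁ hr.le
  have n₄ : ⟪u i₄, circlePoint φ⟫_ℝ < 0 := by by_contra! hc; nlinarith
  obtain ⟨a, b, c, d, ha, hb, hc, hd, hab, hcd⟩ := h
  have n₂ : ⟪u i₂, circlePoint φ⟫_ℝ < 0 := by rw [hab]; nlinarith
  obtain ⟨ε, hε, hlt⟩ : ∃ ε : ℝ, (ε = 1 ∨ ε = -1) ∧ slope φ ε (u i₁) < slope φ ε (u i₄) := by
    rcases lt_or_gt_of_ne (slope_ne_slope (φ := φ) (Or.inl rfl) (hdet _ _ h₁₄) (hx i₁) (hx i₄))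
      with h | h
    · exact ⟨1, Or.inl rfl, h⟩
    · exact ⟨-1, Or.inr rfl, by rw [slope_neg, slope_neg]; linarith⟩
  have hcd' : ∀ x, ⟪u i₃, x⟫_ℝ = (-(d / c)) * ⟪u i₂, x⟫_ℝ + (-c⁻¹) * ⟪u i₄, x⟫_ℝ := fun x => by
    rw [hcd x]; field_simp; ring
  have k₂ : 0 < -(d / c) * ⟪u i₂, circlePoint φ⟫_ℝ :=
    mul_pos_of_neg_of_neg (by simpa using div_pos hd hc) n₂
  have k₄ : 0 < -c⁻¹ * ⟪u i₄, circlePoint φ⟫_ℝ :=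
    mul_pos_of_neg_of_neg (by simpa using hc) n₄
  have n₃ : 0 < ⟪u i₃, circlePoint φ⟫_ℝ := by rw [hcd']; linarith
  -- the sign of the first relation is changed to make its coefficients fit
  obtain ⟨s₁₂, s₂₄⟩ : slope φ ε (u i₁) < slope φ ε (u i₂) ∧ slope φ ε (u i₂) < slope φ ε (u i₄) := by
    have hneg : slope φ ε (-u i₂) = slope φ ε (u i₂) := by
      simp [slope, inner_neg_left, neg_div_neg_eq]
    rw [← hneg]
    refine slope_between (a := a) (b := -b) (fun x => ?_) (by positivity)
      (mul_pos_of_neg_of_neg (by linarith) n₄) hlt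
    rw [inner_neg_left, hab]; ring
  obtain ⟨s₂₃, s₃₄⟩ := slope_between hcd' k₂ k₄ s₂₄
  obtain ⟨l, hl, hsub⟩ := SectorialBrowder.exists_isCode hu hdet t hε hx (l := [i₁, i₂, i₃, i₄]) (by
    simp only [List.pairwise_cons, List.mem_cons, forall_eq_or_imp, List.not_mem_nil,
      false_imp_iff, implies_true, List.Pairwise.nil, and_true]
    exact ⟨⟨s₁₂, s₁₂.trans s₂₃, hlt⟩, ⟨s₂₃, s₂₄⟩, s₃₄⟩)
  refine ⟨φ, ε, l, hl, ?_⟩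
  simpa [n₁, n₂.not_gt, n₃, n₄.not_gt] using hsub

/-! ### Signs -/

/-- Signs on the part of `S₁` that is kept for the transversal. -/
theorem SignRelations.first_sector {u₁ u₂ u₃ u₄ x : E2} (h : SignRelations u₁ u₂ u₃ u₄)
    (h₁ : 0 < ⟪u₁, x⟫_ℝ) (h₄ : ⟪u₄, x⟫_ℝ ≤ 0) : ⟪u₂, x⟫_ℝ < 0 ∧ 0 < ⟪u₃, x⟫_ℝ := by
  obtain ⟨a, b, c, d, ha, hb, hc, hd, hab, hcd⟩ := h
  have h₂ : ⟪u₂, x⟫_ℝ < 0 := by rw [hab]; nlinarith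
  refine ⟨h₂, ?_⟩
  have hc₃ : c * ⟪u₃, x⟫_ℝ = -⟪u₄, x⟫_ℝ - d * ⟪u₂, x⟫_ℝ := by linarith [hcd x]
  exact pos_of_mul_pos_right (by rw [hc₃]; nlinarith) hc.le

/-- Signs on the parts of `S₂` and `S₃` in the sector of the second and third half-planes. One
strict inequality excludes the apex, where all forms vanish. -/
theorem SignRelations.middle_sector {u₁ u₂ u₃ u₄ x : E2} (h : SignRelations u₁ u₂ u₃ u₄)
    (h₂ : 0 ≤ ⟪u₂, x⟫_ℝ) (h₃ : 0 ≤ ⟪u₃, x⟫_ℝ) (h₂₃ : 0 < ⟪u₂, x⟫_ℝ ∨ 0 < ⟪u₃, x⟫_ℝ) :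
    ⟪u₁, x⟫_ℝ < 0 ∧ ⟪u₄, x⟫_ℝ < 0 := by
  obtain ⟨a, b, c, d, ha, hb, hc, hd, hab, hcd⟩ := h
  have hx := hab x
  have h₄ : ⟪u₄, x⟫_ℝ < 0 := by
    rw [hcd]
    rcases h₂₃ with h | h <;> nlinarith
  exact ⟨by by_contra! h; nlinarith, h₄⟩

/-! ### Lines parametrized by the height -/

theorem exists_height_parametrization {l : AffineSubspace ℝ E3} (hl : finrank ℝ l.direction = 1)
    {p q : E3} (hp : p ∈ l) (hq : q ∈ l) (hpq : p 2 ≠ q 2) :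
    ∃ a b : E2, ∀ x : E3, x ∈ l ↔ proj x = a + x 2 • b := by
  have hd : q 2 - p 2 ≠ 0 := sub_ne_zero.2 hpq.symm
  -- Normalizing the direction to vertical component 1 makes the height the parameter of the line.
  let d : E3 := (q 2 - p 2)⁻¹ • (q - p)
  have hd2 : d 2 = 1 := by simp [d, hd]
  have hdl : d ∈ l.direction := l.direction.smul_mem _ (AffineSubspace.vsub_mem_direction hq hp)
  have hd0 : (⟨d, hdl⟩ : l.direction) ≠ 0 := fun h => by
    have : d = 0 := congrArg Subtype.val h
    simp [this] at hd2
  have hspan := (finrank_eq_one_iff_of_nonzero' _ hd0).1 hl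
  refine ⟨proj p - p 2 • proj d, proj d, fun x => ?_⟩
  rw [← AffineSubspace.vsub_right_mem_direction_iff_mem hp, vsub_eq_sub]
  constructor
  · intro hx
    obtain ⟨c, hc⟩ := hspan ⟨x - p, hx⟩
    have hc' : c • d = x - p := congrArg Subtype.val hc
    have h2 : c = x 2 - p 2 := by
      have := congrArg (fun y : E3 => y 2) hc'
      simpa [hd2] using this
    have h3 : proj x = proj p + c • proj d := by
      simp only [← projL_apply, ← map_smul, ← map_add, hc']
      simp
    rw [h3, h2]; module
  · intro hx
    have : x - p = (x 2 - p 2) • d := by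
      have h3 : proj (x - p) = proj ((x 2 - p 2) • d) := by
        rw [← projL_apply, ← projL_apply, map_sub, map_smul, projL_apply, projL_apply, hx,
          projL_apply]
        module
      rw [← lift_proj (x - p), h3, ← lift_proj ((x 2 - p 2) • d)]
      simp [hd2]
    rw [this]
    exact l.direction.smul_mem _ hdl

/-- The line `{(a + s b, s)}`. -/
noncomputable def heightLine (a b : E2) : AffineSubspace ℝ E3 :=
  AffineSubspace.mk' (lift a 0) (Submodule.span ℝ {lift b 1})

theorem finrank_heightLine (a b : E2) : finrank ℝ (heightLine a b).direction = 1 := by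
  rw [heightLine, AffineSubspace.direction_mk']
  refine finrank_span_singleton fun h => ?_
  have := congrArg (fun y : E3 => y 2) h
  simp at this

theorem lift_mem_heightLine (a b : E2) (s : ℝ) : lift (a + s • b) s ∈ heightLine a b := by
  rw [heightLine, AffineSubspace.mem_mk', Submodule.mem_span_singleton]
  refine ⟨s, ?_⟩
  ext i
  fin_cases i <;> simp [lift]

/-! ### Double ratios -/

theorem doubleRatio_line {a b : E2} (hb : b ≠ 0) {s₁ s₂ s₃ s₄ : ℝ} (h₁₂ : s₁ < s₂) (h₂₃ : s₂ < s₃)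
    (h₃₄ : s₃ < s₄) :
    doubleRatio (a + s₁ • b) (a + s₂ • b) (a + s₃ • b) (a + s₄ • b) = heightRatio s₁ s₂ s₃ s₄ := by
  have hdist : ∀ s t : ℝ, s < t → dist (a + s • b) (a + t • b) = (t - s) * ‖b‖ := fun s t hst => by
    rw [dist_comm, dist_add_left, dist_eq_norm, ← sub_smul, norm_smul, Real.norm_eq_abs,
      abs_of_pos (sub_pos.2 hst)]
  have hn : ‖b‖ ≠ 0 := norm_ne_zero_iff.2 hb
  rw [doubleRatio, heightRatio, hdist _ _ h₁₂, hdist _ _ (h₂₃.trans h₃₄), hdist _ _ (h₁₂.trans h₂₃),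
    hdist _ _ h₃₄, mul_div_mul_right _ _ hn, mul_div_mul_right _ _ hn]

/-- Regrouped, the ratio is `AB / (AB + BC)` times `CD / (CD + BC)`. Passing to the outer heights
lengthens `AB` and `CD` and shortens `BC`, so both factors grow. -/
theorem heightRatio_lt {t₁ t₂ t₃ t₄ A B C D : ℝ} (hA : t₁ < A) (hAB : A < B) (hB : B < t₂)
    (h : t₂ < t₃) (hC : t₃ < C) (hCD : C < D) (hD : D < t₄) :
    heightRatio A B C D < heightRatio t₁ t₂ t₃ t₄ := by
  have h₁ : (B - A) / (C - A) < (t₂ - t₁) / (t₃ - t₁) := by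
    rw [div_lt_div_iff₀ (by linarith) (by linarith)]
    nlinarith [mul_pos (sub_pos.2 hA) (sub_pos.2 (hB.trans (h.trans hC))),
      mul_pos (sub_pos.2 hB) (sub_pos.2 (hA.trans (hAB.trans (hB.trans (h.trans hC))))),
      mul_pos (sub_pos.2 (hA.trans (hAB.trans hB))) (sub_pos.2 hC)]
  have h₂ : (D - C) / (D - B) < (t₄ - t₃) / (t₄ - t₂) := by
    rw [div_lt_div_iff₀ (by linarith) (by linarith)]
    nlinarith [mul_pos (sub_pos.2 hD) (sub_pos.2 (hB.trans (h.trans hC))),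
      mul_pos (sub_pos.2 hB) (sub_pos.2 (hC.trans (hCD.trans hD))),
      mul_pos (sub_pos.2 (hC.trans (hCD.trans hD))) (sub_pos.2 hB),
      mul_pos (sub_pos.2 hC) (sub_pos.2 (h.trans (hC.trans (hCD.trans hD))))]
  have e : ∀ s₁ s₂ s₃ s₄ : ℝ, heightRatio s₁ s₂ s₃ s₄ =
      (s₂ - s₁) / (s₃ - s₁) * ((s₄ - s₃) / (s₄ - s₂)) := fun s₁ s₂ s₃ s₄ => by
    rw [heightRatio, div_div_div_eq, div_mul_div_comm, mul_comm (s₄ - s₂)]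
  rw [e, e]
  exact mul_lt_mul'' h₁ h₂ (div_nonneg (by linarith) (by linarith))
    (div_nonneg (by linarith) (by linarith))

/-- If the linear forms with normals `u₁, …, u₄` vanish along the line `a + s b` exactly at the
parameters `A, …, D`, then the double ratio of their kernels is that of `A, …, D`. -/
theorem directionRatio_eq_heightRatio {u₁ u₂ u₃ u₄ a b : E2} {A B C D q₁ q₂ q₃ q₄ : ℝ}
    (hAB : A < B) (hq₁ : q₁ ≠ 0) (hq₂ : q₂ ≠ 0) (hq₃ : q₃ ≠ 0) (hq₄ : q₄ ≠ 0)
    (h₁ : ∀ s, ⟪u₁, a + s • b⟫_ℝ = q₁ * (s - A)) (h₂ : ∀ s, ⟪u₂, a + s • b⟫_ℝ = q₂ * (s - B))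
    (h₃ : ∀ s, ⟪u₃, a + s • b⟫_ℝ = q₃ * (s - C)) (h₄ : ∀ s, ⟪u₄, a + s • b⟫_ℝ = q₄ * (s - D)) :
    directionRatio (boundaryDir u₁) (boundaryDir u₂) (boundaryDir u₃) (boundaryDir u₄) =
      heightRatio A B C D := by
  have key : ∀ {u v : E2} {q r y z : ℝ}, (∀ s, ⟪u, a + s • b⟫_ℝ = q * (s - y)) →
      (∀ s, ⟪v, a + s • b⟫_ℝ = r * (s - z)) → det2 u v * det2 a b = q * r * (z - y) := by
    intro u v q r y z hu hv
    have u0 := hu 0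
    have u1 := hu 1
    have v0 := hv 0
    have v1 := hv 1
    simp only [inner_eq, PiLp.add_apply, PiLp.smul_apply, smul_eq_mul] at u0 u1 v0 v1
    have hua : u 0 * a 0 + u 1 * a 1 = -(q * y) := by linarith
    have hub : u 0 * b 0 + u 1 * b 1 = q := by linarith
    have hva : v 0 * a 0 + v 1 * a 1 = -(r * z) := by linarith
    have hvb : v 0 * b 0 + v 1 * b 1 = r := by linarith
    -- The Binet–Cauchy identity turns the values of the forms along the line into determinants of
    -- the normals.
    have : det2 u v * det2 a b = (u 0 * a 0 + u 1 * a 1) * (v 0 * b 0 + v 1 * b 1) -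
        (u 0 * b 0 + u 1 * b 1) * (v 0 * a 0 + v 1 * a 1) := by simp only [det2]; ring
    rw [this, hua, hub, hva, hvb]; ring
  have hΔ : det2 a b ≠ 0 := fun h0 => by
    have := key h₁ h₂
    rw [h0, mul_zero] at this
    exact mul_ne_zero (mul_ne_zero hq₁ hq₂) (sub_pos.2 hAB).ne' this.symm
  have key' : ∀ {u v : E2} {q r y z : ℝ}, (∀ s, ⟪u, a + s • b⟫_ℝ = q * (s - y)) →
      (∀ s, ⟪v, a + s • b⟫_ℝ = r * (s - z)) → det2 u v = q * r * (z - y) / det2 a b :=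
    fun hu hv => by rw [eq_div_iff hΔ, key hu hv]
  simp only [directionRatio, det2_boundaryDir, heightRatio]
  -- Each `qᵢ` occurs once above and once below, so the leading coefficients cancel, as do the
  -- factors `det2 a b`.
  rw [key' h₁ h₂, key' h₂ h₄, key' h₁ h₃, key' h₃ h₄, div_div_div_cancel_right₀ hΔ,
    div_div_div_cancel_right₀ hΔ, div_div_div_eq, div_div_div_eq,
    show q₁ * q₂ * (B - A) * (q₃ * q₄ * (D - C)) =
      (q₁ * q₂ * q₃ * q₄) * ((B - A) * (D - C)) by ring,
    show q₂ * q₄ * (D - B) * (q₁ * q₃ * (C - A)) =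
      (q₁ * q₂ * q₃ * q₄) * ((D - B) * (C - A)) by ring,
    mul_div_mul_left _ _ (mul_ne_zero (mul_ne_zero (mul_ne_zero hq₁ hq₂) hq₃) hq₄)]

/-! ### Crossings along a transversal, and existence of the sectorial transversal. -/

/-- The zero of an affine function that changes its sign from positive to negative. -/
theorem exists_zero_of_pos_of_neg {p q s t : ℝ} (hst : s < t) (hs : 0 < p + s * q)
    (ht : p + t * q < 0) : ∃ z, s < z ∧ z < t ∧ q < 0 ∧ ∀ x, p + x * q = q * (x - z) := by
  have hq : q < 0 := by by_contra! h; nlinarith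
  refine ⟨-p / q, ?_, ?_, hq, fun x => ?_⟩
  · rw [lt_div_iff_of_neg hq]; linarith
  · rw [div_lt_iff_of_neg hq]; linarith
  · field_simp [hq.ne]; ring

theorem exists_zero_of_neg_of_pos {p q s t : ℝ} (hst : s < t) (hs : p + s * q < 0)
    (ht : 0 < p + t * q) : ∃ z, s < z ∧ z < t ∧ 0 < q ∧ ∀ x, p + x * q = q * (x - z) := by
  obtain ⟨z, h₁, h₂, h₃, h₄⟩ := exists_zero_of_pos_of_neg (p := -p) (q := -q) hst
    (by linarith) (by linarith)
  exact ⟨z, h₁, h₂, by linarith, fun x => by linarith [h₄ x]⟩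

/-- The order of the intersections of a transversal with the four boundary lines. -/
theorem SignRelations.exists_crossings {u₁ u₂ u₃ u₄ a b : E2} (h : SignRelations u₁ u₂ u₃ u₄)
    {t₁ t₂ t₃ t₄ : ℝ} (ht₁₂ : t₁ < t₂) (ht₂₃ : t₂ < t₃) (ht₃₄ : t₃ < t₄)
    (h₁₁ : 0 < ⟪u₁, a + t₁ • b⟫_ℝ) (h₁₄ : ⟪u₄, a + t₁ • b⟫_ℝ ≤ 0)
    (h₂₂ : 0 < ⟪u₂, a + t₂ • b⟫_ℝ) (h₂₃ : 0 ≤ ⟪u₃, a + t₂ • b⟫_ℝ)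
    (h₃₃ : 0 < ⟪u₃, a + t₃ • b⟫_ℝ) (h₃₂ : 0 ≤ ⟪u₂, a + t₃ • b⟫_ℝ)
    (h₄₄ : 0 < ⟪u₄, a + t₄ • b⟫_ℝ) :
    ∃ A B C D q₁ q₂ q₃ q₄ : ℝ, t₁ < A ∧ A < B ∧ B < t₂ ∧ t₃ < C ∧ C < D ∧ D < t₄ ∧
      q₁ ≠ 0 ∧ q₂ ≠ 0 ∧ q₃ ≠ 0 ∧ q₄ ≠ 0 ∧
      (∀ s, ⟪u₁, a + s • b⟫_ℝ = q₁ * (s - A)) ∧ (∀ s, ⟪u₂, a + s • b⟫_ℝ = q₂ * (s - B)) ∧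
      (∀ s, ⟪u₃, a + s • b⟫_ℝ = q₃ * (s - C)) ∧ (∀ s, ⟪u₄, a + s • b⟫_ℝ = q₄ * (s - D)) := by
  have h₁₂ := (h.first_sector h₁₁ h₁₄).1
  have h₂₁ := (h.middle_sector h₂₂.le h₂₃ (Or.inl h₂₂)).1
  obtain ⟨h₃₁, h₃₄⟩ := h.middle_sector h₃₂ h₃₃.le (Or.inr h₃₃)
  obtain ⟨α, β, γ, δ, hα, hβ, hγ, hδ, hαβ, hγδ⟩ := h
  have hlin : ∀ (u : E2) (s : ℝ), ⟪u, a + s • b⟫_ℝ = ⟪u, a⟫_ℝ + s * ⟪u, b⟫_ℝ := fun u s => by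
    rw [inner_add_right, inner_smul_right]
  have hαβ' := fun s : ℝ => hαβ (a + s • b)
  have hγδ' := fun s : ℝ => hγδ (a + s • b)
  simp only [hlin] at *
  obtain ⟨A, hA, hA', q₁, hf₁⟩ := exists_zero_of_pos_of_neg ht₁₂ h₁₁ h₂₁
  obtain ⟨B, hB, hB', q₂, hf₂⟩ := exists_zero_of_neg_of_pos ht₁₂ h₁₂ h₂₂
  obtain ⟨D, hD, hD', q₄, hf₄⟩ := exists_zero_of_neg_of_pos ht₃₄ h₃₄ h₄₄
  -- No hypothesis gives the sign of the third form at `t₄`; it follows from the second relation, as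
  -- the second and fourth forms are positive there.
  have h₄₃ : ⟪u₃, a⟫_ℝ + t₄ * ⟪u₃, b⟫_ℝ < 0 := by
    have h₂ : 0 < ⟪u₂, a⟫_ℝ + t₄ * ⟪u₂, b⟫_ℝ := by
      rw [hf₂]; exact mul_pos q₂ (by linarith)
    have := hγδ' t₄
    by_contra! hc
    nlinarith
  obtain ⟨C, hC, hC', q₃, hf₃⟩ := exists_zero_of_pos_of_neg ht₃₄ h₃₃ h₄₃
  simp only [hf₁, hf₂, hf₃, hf₄] at hαβ' hγδ'
  -- At `A` the first relation leaves a positive multiple of the fourth form, which is still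
  -- negative; so the second form has not yet changed sign.
  have hAB : A < B := by
    have := hαβ' A
    by_contra! hc
    nlinarith [mul_pos hβ (mul_pos q₄ (sub_pos.2 (hA'.trans (ht₂₃.trans hD)))),
      mul_nonneg q₂.le (sub_nonneg.2 hc)]
  -- At `C` the second relation leaves a negative multiple of the second form, which is positive; so
  -- the fourth form has not yet changed sign.
  have hCD : C < D := by
    have := hγδ' C
    by_contra! hc
    nlinarith [mul_pos hδ (mul_pos q₂ (sub_pos.2 (hB'.trans (ht₂₃.trans hC)))),
      mul_nonneg q₄.le (sub_nonneg.2 hc)]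
  exact ⟨A, B, C, D, _, _, _, _, hA, hAB, hB', hC, hCD, hD', q₁.ne, q₂.ne', q₃.ne, q₄.ne',
    hf₁, hf₂, hf₃, hf₄⟩

/-- The sectorial transversal: a line through the four sections that meets the first and the third
of them in the prescribed sectors. -/
theorem SignRelations.exists_transversal {𝔹 : Set RP3} (h𝔹 : IsConvexConcave infiniteLine 𝔹)
    {t₁ t₂ t₃ t₄ : ℝ} (h₁₂ : t₁ < t₂) (h₂₃ : t₂ < t₃) (h₃₄ : t₃ < t₄) {u₁ u₂ u₃ u₄ : E2}
    (h : SignRelations u₁ u₂ u₃ u₄)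
    (hS₁ : ∀ x ∈ planarSection 𝔹 t₁, 0 < ⟪u₁, x⟫_ℝ) (hS₂ : ∀ x ∈ planarSection 𝔹 t₂, 0 < ⟪u₂, x⟫_ℝ)
    (hS₃ : ∀ x ∈ planarSection 𝔹 t₃, 0 < ⟪u₃, x⟫_ℝ) (hS₄ : ∀ x ∈ planarSection 𝔹 t₄, 0 < ⟪u₄, x⟫_ℝ)
    (hne : ∃ x ∈ planarSection 𝔹 t₁, ⟪u₄, x⟫_ℝ ≤ 0) :
    ∃ a b : E2, a + t₁ • b ∈ planarSection 𝔹 t₁ ∧ a + t₂ • b ∈ planarSection 𝔹 t₂ ∧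
      a + t₃ • b ∈ planarSection 𝔹 t₃ ∧ a + t₄ • b ∈ planarSection 𝔹 t₄ ∧
      ⟪u₄, a + t₁ • b⟫_ℝ ≤ 0 ∧ 0 ≤ ⟪u₃, a + t₂ • b⟫_ℝ ∧ 0 ≤ ⟪u₂, a + t₃ • b⟫_ℝ ∧
      ⟪u₁, a + t₄ • b⟫_ℝ ≤ 0 := by
  have hlin : ∀ (u a b : E2) (s : ℝ), ⟪u, a + s • b⟫_ℝ = ⟪u, a⟫_ℝ + s * ⟪u, b⟫_ℝ :=
    fun u a b s => by rw [inner_add_right, inner_smul_right]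
  have c₁ : IsClosed {x : E2 | ⟪u₄, x⟫_ℝ ≤ 0} :=
    isClosed_le (continuous_const.inner continuous_id) continuous_const
  have c₃ : IsClosed {x : E2 | 0 ≤ ⟪u₂, x⟫_ℝ} :=
    isClosed_le continuous_const (continuous_const.inner continuous_id)
  have v₁ : Convex ℝ {x : E2 | ⟪u₄, x⟫_ℝ ≤ 0} :=
    convex_halfSpace_le (innerSL ℝ u₄).isBoundedLinearMap.toIsLinearMap 0
  have v₃ : Convex ℝ {x : E2 | 0 ≤ ⟪u₂, x⟫_ℝ} :=
    convex_halfSpace_ge (innerSL ℝ u₂).isBoundedLinearMap.toIsLinearMap 0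
  obtain ⟨a, b, ⟨k₁, k₁'⟩, k₂, ⟨k₃, k₃'⟩, k₄⟩ := SectorialBrowder.exists_transversal
    (S₁ := planarSection 𝔹 t₁ ∩ {x | ⟪u₄, x⟫_ℝ ≤ 0}) (S₂ := planarSection 𝔹 t₂)
    (S₃ := planarSection 𝔹 t₃ ∩ {x | 0 ≤ ⟪u₂, x⟫_ℝ}) (S₄ := planarSection 𝔹 t₄)
    (t₂ := t₂) (h₁₂.trans h₂₃) h₃₄
    ((h𝔹.isCompact_planarSection t₁).inter_right c₁) (h𝔹.isCompact_planarSection t₂)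
    ((h𝔹.isCompact_planarSection t₃).inter_right c₃) (h𝔹.isCompact_planarSection t₄)
    ((h𝔹.convex_planarSection t₁).inter v₁) (h𝔹.convex_planarSection t₂)
    ((h𝔹.convex_planarSection t₃).inter v₃) (h𝔹.convex_planarSection t₄) hne
    (by
      rintro x ⟨hx, hx'⟩
      obtain ⟨a, b, rfl, k₂, k₃⟩ := h𝔹.exists_line h₁₂.ne (h₁₂.trans h₂₃).ne h₂₃.ne hx
      refine ⟨a, b, rfl, k₂, k₃, ?_⟩
      -- The form of `u₂` is negative at `t₁` and positive at `t₂`, hence still positive at `t₃`.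
      have e₁ := (h.first_sector (hS₁ _ hx) hx').1
      have e₂ := hS₂ _ k₂
      change 0 ≤ ⟪u₂, a + t₃ • b⟫_ℝ
      rw [hlin] at *
      have hb : 0 < ⟪u₂, b⟫_ℝ := by by_contra! hc; nlinarith
      nlinarith)
    (by
      rintro x ⟨hx, hx'⟩
      obtain ⟨a, b, rfl, k₁, k₄⟩ := h𝔹.exists_line (h₁₂.trans h₂₃).ne' h₃₄.ne
        (h₁₂.trans (h₂₃.trans h₃₄)).ne hx
      refine ⟨a, b, rfl, ⟨k₁, ?_⟩, k₄⟩
      -- The form of `u₄` is negative at `t₃` and positive at `t₄`, hence negative at `t₁`.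
      have e₃ := (h.middle_sector hx' (hS₃ _ hx).le (Or.inr (hS₃ _ hx))).2
      have e₄ := hS₄ _ k₄
      change ⟪u₄, a + t₁ • b⟫_ℝ ≤ 0
      rw [hlin] at *
      have hb : 0 < ⟪u₄, b⟫_ℝ := by by_contra! hc; nlinarith
      nlinarith)
  -- The two remaining sector conditions are automatic: `u₃` is positive at `t₁` and `t₃`, hence at
  -- `t₂`, while `u₁` falls from positive at `t₁` to negative at `t₃` and stays negative.
  refine ⟨a, b, k₁, k₂, k₃, k₄, k₁', ?_, k₃', ?_⟩
  · have e₁ := (h.first_sector (hS₁ _ k₁) k₁').2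
    have e₃ := hS₃ _ k₃
    rw [hlin] at *
    rcases le_total 0 ⟪u₃, b⟫_ℝ with hb | hb <;> nlinarith
  · have e₁ := hS₁ _ k₁
    have e₃ := (h.middle_sector k₃' (hS₃ _ k₃).le (Or.inr (hS₃ _ k₃))).1
    rw [hlin] at *
    have hb : ⟪u₁, b⟫_ℝ < 0 := by by_contra! hc; nlinarith
    nlinarith

/-- A line that meets a boundary line at the single parameter `z`. -/
theorem proj_line_inter_frontier {l : AffineSubspace ℝ E3} {a b u : E2} (hu : u ≠ 0) {t q z : ℝ}
    (hl : ∀ x : E3, x ∈ l ↔ proj x = a + x 2 • b) (hq : q ≠ 0)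
    (h : ∀ s, ⟪u, a + s • b⟫_ℝ = q * (s - z)) :
    proj '' l ∩ frontier (proj '' halfPlane u t) = {a + z • b} := by
  ext y
  rw [mem_inter_iff, mem_frontier_proj_halfPlane hu, mem_singleton_iff]
  constructor
  · rintro ⟨⟨x, hx, rfl⟩, hy⟩
    have hx' := (hl x).1 hx
    rw [hx', h] at hy
    rw [hx', sub_eq_zero.1 ((mul_eq_zero.1 hy).resolve_left hq)]
  · rintro rfl
    exact ⟨⟨lift (a + z • b) z, (hl _).2 (by simp), by simp⟩, by rw [h]; simp⟩

end SectorialBrowder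

/-! ### Assembly of the theorem. -/

theorem mainTheorem5
    (𝔹 : Set RP3) (h𝔹 : IsConvexConcave infiniteLine 𝔹)
    {m : ℕ} (t : Fin m → ℝ) (ht : StrictMono t)
    (u : Fin m → E2) (hu : ∀ i j, i ≠ j → LinearIndependent ℝ ![u i, u j])
    (S H : Fin m → Set E3)
    (hS : ∀ i, S i = horizontalSection 𝔹 (t i))
    (hH : ∀ i, H i = halfPlane (u i) (t i))
    (hSH : ∀ i, proj '' S i ⊆ interior (proj '' H i))
    (i₁ i₂ i₃ i₄ : Fin m) (h₁₂ : i₁ < i₂) (h₂₃ : i₂ < i₃) (h₃₄ : i₃ < i₄) :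
    -- the two combinatorial conditions in terms of codes
    ((proj '' H i₁ ∩ projCompl (H i₄) ⊆ projCompl (H i₂) ∧
        proj '' H i₃ ∩ proj '' H i₂ ⊆ projCompl (H i₄)) ↔
      ∃ (φ ε : ℝ) (c : List (Fin m × Bool)),
        IsCode (fun i => proj '' H i) φ ε c ∧
        [(i₁, true), (i₂, false), (i₃, true), (i₄, false)].Sublist c) ∧
    (proj '' H i₁ ∩ projCompl (H i₄) ⊆ projCompl (H i₂) →
      proj '' H i₃ ∩ proj '' H i₂ ⊆ projCompl (H i₄) →
      (proj '' S i₁ ∩ projCompl (H i₄)).Nonempty →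
      (proj '' S i₂ ∩ proj '' H i₃).Nonempty ∧
      (proj '' S i₃ ∩ proj '' H i₂).Nonempty ∧
      (proj '' S i₄ ∩ projCompl (H i₁)).Nonempty ∧
      -- the line
      (∃ l : AffineSubspace ℝ E3, finrank ℝ l.direction = 1 ∧
        ((l : Set E3) ∩ (S i₁ ∩ halfSpaceCompl (H i₄))).Nonempty ∧
        ((l : Set E3) ∩ (S i₂ ∩ halfSpace (H i₃))).Nonempty ∧
        ((l : Set E3) ∩ (S i₃ ∩ halfSpace (H i₂))).Nonempty ∧
        ((l : Set E3) ∩ (S i₄ ∩ halfSpaceCompl (H i₁))).Nonempty) ∧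
      -- the two double ratios, read off any such line
      (∀ l : AffineSubspace ℝ E3, finrank ℝ l.direction = 1 →
        ∀ p₁ ∈ (l : Set E3) ∩ (S i₁ ∩ halfSpaceCompl (H i₄)),
        ∀ p₂ ∈ (l : Set E3) ∩ (S i₂ ∩ halfSpace (H i₃)),
        ∀ p₃ ∈ (l : Set E3) ∩ (S i₃ ∩ halfSpace (H i₂)),
        ∀ p₄ ∈ (l : Set E3) ∩ (S i₄ ∩ halfSpaceCompl (H i₁)),
        ∃ A B C D : E2,
          proj '' l ∩ frontier (proj '' H i₁) = {A} ∧
          proj '' l ∩ frontier (proj '' H i₂) = {B} ∧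
          proj '' l ∩ frontier (proj '' H i₃) = {C} ∧
          proj '' l ∩ frontier (proj '' H i₄) = {D} ∧
          [A, B, C, D].Nodup ∧
          doubleRatio A B C D =
            directionRatio (boundaryDir (u i₁)) (boundaryDir (u i₂))
              (boundaryDir (u i₃)) (boundaryDir (u i₄)) ∧
          doubleRatio (proj p₁) (proj p₂) (proj p₃) (proj p₄) =
            heightRatio (t i₁) (t i₂) (t i₃) (t i₄)) ∧
      -- the inequality between the double ratios
      directionRatio (boundaryDir (u i₁)) (boundaryDir (u i₂))
          (boundaryDir (u i₃)) (boundaryDir (u i₄)) <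
        heightRatio (t i₁) (t i₂) (t i₃) (t i₄)) := by
  obtain rfl : S = fun i => horizontalSection 𝔹 (t i) := funext hS
  obtain rfl : H = fun i => halfPlane (u i) (t i) := funext hH
  have hdet : ∀ i j, i ≠ j → det2 (u i) (u j) ≠ 0 := fun i j hij => det2_ne_zero (hu i j hij)
  have hu0 : ∀ i, u i ≠ 0 := by
    intro i h0
    obtain ⟨j, hj⟩ : ∃ j, i ≠ j := by
      by_cases h : i = i₁
      · exact ⟨i₂, h ▸ h₁₂.ne⟩
      · exact ⟨i₁, h⟩
    exact (hu i j hj).ne_zero 0 h0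
  have hpos : ∀ i, ∀ x ∈ planarSection 𝔹 (t i), 0 < ⟪u i, x⟫_ℝ := fun i x hx =>
    (mem_interior_proj_halfPlane (hu0 i)).1
      (hSH i (by rw [proj_image_horizontalSection]; exact hx))
  have hrel : proj '' halfPlane (u i₁) (t i₁) ∩ projCompl (halfPlane (u i₄) (t i₄)) ⊆
        projCompl (halfPlane (u i₂) (t i₂)) →
      proj '' halfPlane (u i₃) (t i₃) ∩ proj '' halfPlane (u i₂) (t i₂) ⊆
        projCompl (halfPlane (u i₄) (t i₄)) →
      SignRelations (u i₁) (u i₂) (u i₃) (u i₄) := by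
    intro c₁ c₂
    rw [proj_image_halfPlane] at c₁
    rw [proj_image_halfPlane, proj_image_halfPlane] at c₂
    exact signRelations_of_sectors (hdet _ _ h₁₂.ne) (hdet _ _ (h₁₂.trans (h₂₃.trans h₃₄)).ne)
      (hdet _ _ h₂₃.ne') (hdet _ _ (h₂₃.trans h₃₄).ne) (hdet _ _ h₃₄.ne)
      (fun x hx hx' => (mem_projCompl_halfPlane (hu0 _)).1
        (c₁ ⟨hx, (mem_projCompl_halfPlane (hu0 _)).2 hx'⟩))
      (fun x hx hx' => (mem_projCompl_halfPlane (hu0 _)).1 (c₂ ⟨hx, hx'⟩))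
  refine ⟨⟨fun ⟨c₁, c₂⟩ => (hrel c₁ c₂).exists_isCode hu0 hdet t (h₁₂.trans (h₂₃.trans h₃₄)).ne, ?_⟩,
    ?_⟩
  · rintro ⟨φ, ε, c, hc, hsub⟩
    obtain ⟨s₁, s₂⟩ := sectors_of_isCode hu0 hc hsub
    simp only [proj_image_halfPlane]
    exact ⟨fun x hx => (mem_projCompl_halfPlane (hu0 _)).2
        (s₁ x hx.1 ((mem_projCompl_halfPlane (hu0 _)).1 hx.2)),
      fun x hx => (mem_projCompl_halfPlane (hu0 _)).2 (s₂ x hx.1 hx.2)⟩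
  intro c₁ c₂ hne
  have h := hrel c₁ c₂
  have t₁₂ := ht h₁₂
  have t₂₃ := ht h₂₃
  have t₃₄ := ht h₃₄
  obtain ⟨a, b, k₁, k₂, k₃, k₄, n₁, n₂, n₃, n₄⟩ := h.exists_transversal h𝔹 t₁₂ t₂₃ t₃₄
    (hpos _) (hpos _) (hpos _) (hpos _) (by
      obtain ⟨x, hx, hx'⟩ := hne
      rw [proj_image_horizontalSection] at hx
      exact ⟨x, hx, (mem_projCompl_halfPlane (hu0 _)).1 hx'⟩)
  simp only [proj_image_horizontalSection]
  refine ⟨⟨_, k₂, by rwa [proj_image_halfPlane]⟩, ⟨_, k₃, by rwa [proj_image_halfPlane]⟩,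
    ⟨_, k₄, (mem_projCompl_halfPlane (hu0 _)).2 n₄⟩,
    ⟨heightLine a b, finrank_heightLine a b,
      ⟨_, lift_mem_heightLine a b (t i₁), lift_mem_horizontalSection k₁,
        (mem_halfSpaceCompl_halfPlane (hu0 _)).2 (by simpa using n₁)⟩,
      ⟨_, lift_mem_heightLine a b (t i₂), lift_mem_horizontalSection k₂,
        mem_halfSpace_halfPlane.2 (by simpa using n₂)⟩,
      ⟨_, lift_mem_heightLine a b (t i₃), lift_mem_horizontalSection k₃,
        mem_halfSpace_halfPlane.2 (by simpa using n₃)⟩,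
      ⟨_, lift_mem_heightLine a b (t i₄), lift_mem_horizontalSection k₄,
        (mem_halfSpaceCompl_halfPlane (hu0 _)).2 (by simpa using n₄)⟩⟩, ?_, ?_⟩
  · rintro l hl p₁ ⟨l₁, s₁, m₁⟩ p₂ ⟨l₂, s₂, m₂⟩ p₃ ⟨l₃, s₃, m₃⟩ p₄ ⟨l₄, s₄, -⟩
    obtain ⟨z₁, s₁⟩ := mem_horizontalSection_iff.1 s₁
    obtain ⟨z₂, s₂⟩ := mem_horizontalSection_iff.1 s₂
    obtain ⟨z₃, s₃⟩ := mem_horizontalSection_iff.1 s₃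
    obtain ⟨z₄, s₄⟩ := mem_horizontalSection_iff.1 s₄
    obtain ⟨a, b, hab⟩ := exists_height_parametrization hl l₁ l₂ (by rw [z₁, z₂]; exact t₁₂.ne)
    have e₁ := (hab _).1 l₁
    have e₂ := (hab _).1 l₂
    have e₃ := (hab _).1 l₃
    have e₄ := (hab _).1 l₄
    rw [z₁] at e₁
    rw [z₂] at e₂
    rw [z₃] at e₃
    rw [z₄] at e₄
    obtain ⟨A, B, C, D, q₁, q₂, q₃, q₄, hA, hAB, hB, hC, hCD, hD, hq₁, hq₂, hq₃, hq₄,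
      f₁, f₂, f₃, f₄⟩ := h.exists_crossings (a := a) (b := b) t₁₂ t₂₃ t₃₄
        (e₁ ▸ hpos _ _ s₁) (e₁ ▸ (mem_halfSpaceCompl_halfPlane (hu0 _)).1 m₁)
        (e₂ ▸ hpos _ _ s₂) (e₂ ▸ mem_halfSpace_halfPlane.1 m₂)
        (e₃ ▸ hpos _ _ s₃) (e₃ ▸ mem_halfSpace_halfPlane.1 m₃) (e₄ ▸ hpos _ _ s₄)
    have hBC : B < C := hB.trans (t₂₃.trans hC)
    -- A vertical line would make the first form constant, although its leading coefficient `q₁` is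
    -- non-zero.
    have hb : b ≠ 0 := by
      rintro rfl
      have z₀ := f₁ A
      have z₁ := f₁ (A + 1)
      simp only [smul_zero] at z₀ z₁
      exact hq₁ (by linarith)
    have hinj : ∀ {s r : ℝ}, s < r → a + s • b ≠ a + r • b := fun hsr he =>
      hsr.ne (smul_left_injective ℝ hb (add_left_cancel he))
    refine ⟨a + A • b, a + B • b, a + C • b, a + D • b,
      proj_line_inter_frontier (hu0 _) hab hq₁ f₁, proj_line_inter_frontier (hu0 _) hab hq₂ f₂,
      proj_line_inter_frontier (hu0 _) hab hq₃ f₃, proj_line_inter_frontier (hu0 _) hab hq₄ f₄,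
      ?_, ?_, ?_⟩
    · simp only [List.nodup_cons, List.mem_cons, List.not_mem_nil, or_false, not_or,
        not_false_eq_true, List.nodup_nil, and_true]
      exact ⟨⟨hinj hAB, hinj (hAB.trans hBC), hinj (hAB.trans (hBC.trans hCD))⟩,
        ⟨hinj hBC, hinj (hBC.trans hCD)⟩, hinj hCD⟩
    · rw [doubleRatio_line hb hAB hBC hCD,
        directionRatio_eq_heightRatio hAB hq₁ hq₂ hq₃ hq₄ f₁ f₂ f₃ f₄]
    · rw [e₁, e₂, e₃, e₄, doubleRatio_line hb t₁₂ t₂₃ t₃₄]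
  -- The inequality does not mention a line; the transversal constructed above is used to prove it.
  · obtain ⟨A, B, C, D, q₁, q₂, q₃, q₄, hA, hAB, hB, hC, hCD, hD, hq₁, hq₂, hq₃, hq₄,
      f₁, f₂, f₃, f₄⟩ := h.exists_crossings t₁₂ t₂₃ t₃₄ (hpos _ _ k₁) n₁ (hpos _ _ k₂) n₂
        (hpos _ _ k₃) n₃ (hpos _ _ k₄)
    rw [directionRatio_eq_heightRatio hAB hq₁ hq₂ hq₃ hq₄ f₁ f₂ f₃ f₄]
    exact heightRatio_lt hA hAB hB t₂₃ hC hCD hD
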